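/- **Theorem (Strong threshold, $\mathbf x$ a priori known to be non-negative; lifted lower bound).** Let $\operatorname{erf}(x)=\frac{2}{\sqrt\pi}\int_0^x e^{-t^2}dt$ and $\operatorname{erfc}=1-\operatorname{erf}$. Let $\alpha>0$ and $\beta\ge 0$ be constants. For $c>0$ put $$\widehat\gamma=\frac{2c-\sqrt{4c^2+16\alpha}}{8},\qquad I_{sph}(c,\alpha)=\widehat\gamma-\frac{\alpha}{2c}\log\Big(1-\frac{c}{2\widehat\gamma}\Big).$$ For $c>0$, $\gamma>c/2$, $\nu_1\ge 0$, $\nu_2\ge 0$ put $$p=\frac{c}{4\gamma},\quad q=-\frac{c\nu_1}{2\gamma},\quad r=c\Big(\frac{\nu_1^2}{4\gamma}-\nu_2\Big),\quad r_1=c\Big(\frac{\nu_1^2}{4\gamma}+\nu_2\Big),\quad d=\frac{q}{\sqrt{2(1-2p)}},$$ $$C_1=\frac{e^{d^2+r}}{\sqrt{1/2-p}},\quad C_3=\frac{e^{d^2+r_1}}{\sqrt{1/2-p}},\quad b=\big(\nu_1-\sqrt{8\gamma\nu_2}\big)\sqrt{1/2-p},\quad a=\nu_1\sqrt{1/2-p},$$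 $$I^{(1+)}=\frac{C_1}{2\sqrt2}\big(2-\operatorname{erfc}(b-d)\big),\quad I^{(2+)}=\frac{e^{c\nu_2}}{2}\Big(\operatorname{erfc}\Big(\frac{b}{\sqrt2\sqrt{1/2-p}}\Big)-\operatorname{erfc}\Big(\frac{\nu_1}{\sqrt2}\Big)\Big),\quad I^{(3+)}=\frac{C_3}{2\sqrt2}\operatorname{erfc}(a-d),$$ and $I^+=I^{(1+)}+I^{(2+)}+I^{(3+)}$. Further let $$I^+_{str}(c,\beta)=\inf_{\gamma>c/2,\ \nu_1\ge0,\ \nu_2\ge0}\Big(\nu_2(2\beta-1)+\gamma+\frac1c\log I^+\Big).$$ (1) For all such $c,\gamma,\nu_1,\nu_2$, one has equivalently $I^+=\mathbb E\,e^{c\,t^+(h)}$ (in particular the expectation is finite), where $h$ is standard normal and $$t^+(h)=\begin{cases}\frac{h^2+\nu_1^2}{4\gamma}-\frac{h\nu_1}{2\gamma}-\nu_2,& h\le \nu_1-\sqrt{8\gamma\nu_2},\\ \nu_2,& \nu_1-\sqrt{8\gamma\nu_2}< h\le\nu_1,\\ \frac{h^2+\nu_1^2}{4\gamma}-\frac{h\nu_1}{2\gamma}+\nu_2,&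 h>\nu_1.\end{cases}$$ (2) If $$\inf_{c>0}\Big(-\frac c2+I^+_{str}(c,\beta)+I_{sph}(c,\alpha)\Big)<0,$$ then there are $\delta>0$ and $N$, depending only on $\alpha$ and $\beta$, such that for all $n\ge N$ and all $m,k$ with $m\ge\alpha n$ and $k\le\beta n$ (in particular when $m=\alpha n$ and $k=\beta n$) the following holds with probability at least $1-e^{-\delta n}$ for an $m\times n$ matrix $A$ with i.i.d. standard normal entries: simultaneously for every vector $x\in\mathbb R^n$ with non-negative components, at most $k$ of them non-zero, the unique solution of $$\min\|z\|_1\quad\text{subject to}\quad Az=Ax,\quad z_i\ge0\ (1\le i\le n)$$ is $z=x$. -/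

import Mathlib

open MeasureTheory ProbabilityTheory

namespace NonnegL1

noncomputable section

/-! ### Recovery by `ℓ₁`-minimization over the non-negative orthant -/

/-- The law of an `m × n` random matrix with i.i.d. standard normal entries. -/
def gaussianMatrix (m n : ℕ) : Measure (Fin m → Fin n → ℝ) :=
  Measure.pi fun _ => Measure.pi fun _ => gaussianReal 0 1

/-- The `ℓ₁`-norm of a vector. -/
def l1Norm {n : ℕ} (x : Fin n → ℝ) : ℝ := ∑ i, |x i|

/-- `x` has at most `k` non-zero components. -/
def IsSparse {n : ℕ} (k : ℕ) (x : Fin n → ℝ) : Prop :=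
  (Finset.univ.filter fun i => x i ≠ 0).card ≤ k

/-- The constraints `A z = y`, `z ≥ 0`. -/
def Feasible {m n : ℕ} (A : Matrix (Fin m) (Fin n) ℝ) (y : Fin m → ℝ) (z : Fin n → ℝ) : Prop :=
  A.mulVec z = y ∧ ∀ i, 0 ≤ z i

/-- `z` is a solution (a minimizer) of: minimize `‖z‖₁` subject to `A z = y`, `z ≥ 0`. -/
def IsSolution {m n : ℕ} (A : Matrix (Fin m) (Fin n) ℝ) (y : Fin m → ℝ) (z : Fin n → ℝ) : Prop :=
  Feasible A y z ∧ ∀ z', Feasible A y z' → l1Norm z ≤ l1Norm z'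

/-- For every non-negative `k`-sparse `x`, the solution of the program with data `y = A x`
is `x` (it exists, is unique, and equals `x`). -/
def RecoversAll {m n : ℕ} (k : ℕ) (A : Matrix (Fin m) (Fin n) ℝ) : Prop :=
  ∀ x : Fin n → ℝ, (∀ i, 0 ≤ x i) → IsSparse k x →
    ∀ z : Fin n → ℝ, IsSolution A (A.mulVec x) z ↔ z = x

/-! ### The error function -/

/-- `erf x = (2/√π) ∫₀ˣ e^{-t²} dt`. -/
def erf (x : ℝ) : ℝ := 2 / √Real.pi * ∫ t in (0 : ℝ)..x, Real.exp (-t ^ 2)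

/-- `erfc = 1 - erf`. -/
def erfc (x : ℝ) : ℝ := 1 - erf x

/-! ### The spherical part -/

/-- `γ̂_sph = (2c - √(4c² + 16α)) / 8`. -/
def gammaSph (c α : ℝ) : ℝ := (2 * c - √(4 * c ^ 2 + 16 * α)) / 8

/-- `I_sph(c, α) = γ̂ - (α / 2c) log (1 - c / (2γ̂))`. -/
def ISph (c α : ℝ) : ℝ :=
  gammaSph c α - α / (2 * c) * Real.log (1 - c / (2 * gammaSph c α))

/-! ### The quantity `I⁺`, in its two forms -/

/-- The function `t⁺` of a standard normal variable `h`, by cases. -/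
def tPlus (γ ν₁ ν₂ h : ℝ) : ℝ :=
  if h ≤ ν₁ - √(8 * γ * ν₂) then
    (h ^ 2 + ν₁ ^ 2) / (4 * γ) - h * ν₁ / (2 * γ) - ν₂
  else if h ≤ ν₁ then ν₂
  else (h ^ 2 + ν₁ ^ 2) / (4 * γ) - h * ν₁ / (2 * γ) + ν₂

/-- `p⁺`. -/
def pPlus (c γ : ℝ) : ℝ := c / 4 / γ

/-- `q⁺`. -/
def qPlus (c γ ν₁ : ℝ) : ℝ := -c * ν₁ / 2 / γ

/-- `r⁺`. -/
def rPlus (c γ ν₁ ν₂ : ℝ) : ℝ := c * (ν₁ ^ 2 / 4 / γ - ν₂)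

/-- `r₁⁺`. -/
def r1Plus (c γ ν₁ ν₂ : ℝ) : ℝ := c * (ν₁ ^ 2 / 4 / γ + ν₂)

/-- `d⁺`. -/
def dPlus (c γ ν₁ : ℝ) : ℝ := qPlus c γ ν₁ / √(2 * (1 - 2 * pPlus c γ))

/-- `C₁⁺`. -/
def C1Plus (c γ ν₁ ν₂ : ℝ) : ℝ :=
  Real.exp (dPlus c γ ν₁ ^ 2 + rPlus c γ ν₁ ν₂) / √(1 / 2 - pPlus c γ)

/-- `C₃⁺`. -/
def C3Plus (c γ ν₁ ν₂ : ℝ) : ℝ :=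
  Real.exp (dPlus c γ ν₁ ^ 2 + r1Plus c γ ν₁ ν₂) / √(1 / 2 - pPlus c γ)

/-- `b⁺`. -/
def bPlus (c γ ν₁ ν₂ : ℝ) : ℝ := (ν₁ - √(8 * γ * ν₂)) * √(1 / 2 - pPlus c γ)

/-- `a⁺`. -/
def aPlus (c γ ν₁ : ℝ) : ℝ := ν₁ * √(1 / 2 - pPlus c γ)

/-- `I⁽¹⁺⁾`, the contribution of `h ≤ ν₁ - √(8γν₂)` (with its normalization `1/(2√2)`). -/
def I1Plus (c γ ν₁ ν₂ : ℝ) : ℝ :=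
  C1Plus c γ ν₁ ν₂ / (2 * √2) * (2 - erfc (bPlus c γ ν₁ ν₂ - dPlus c γ ν₁))

/-- `I⁽²⁺⁾`, the contribution of `ν₁ - √(8γν₂) ≤ h ≤ ν₁`. -/
def I2Plus (c γ ν₁ ν₂ : ℝ) : ℝ :=
  Real.exp (c * ν₂) / 2 *
    (erfc (bPlus c γ ν₁ ν₂ / √2 / √(1 / 2 - pPlus c γ)) - erfc (ν₁ / √2))

/-- `I⁽³⁺⁾`, the contribution of `ν₁ ≤ h` (with its normalization `1/(2√2)`). -/
def I3Plus (c γ ν₁ ν₂ : ℝ) : ℝ :=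
  C3Plus c γ ν₁ ν₂ / (2 * √2) * erfc (aPlus c γ ν₁ - dPlus c γ ν₁)

/-- `I⁺ = I⁽¹⁺⁾ + I⁽²⁺⁾ + I⁽³⁺⁾`. -/
def IPlus (c γ ν₁ ν₂ : ℝ) : ℝ := I1Plus c γ ν₁ ν₂ + I2Plus c γ ν₁ ν₂ + I3Plus c γ ν₁ ν₂

/-- `I⁺_str(c, β)`: the infimum over `γ > c/2` (so that `c/(4γ) < 1/2`), `ν₁ ≥ 0`, `ν₂ ≥ 0` of
`ν₂(2β - 1) + γ + (1/c) log I⁺`. For `c > 0` and `β ≥ 0` the set is non-empty and bounded below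
by `0`, because `I⁺ ≥ e^{cν₂}`. -/
def IStrPlus (c β : ℝ) : ℝ :=
  sInf {v : ℝ | ∃ γ ν₁ ν₂ : ℝ, c / 2 < γ ∧ 0 ≤ ν₁ ∧ 0 ≤ ν₂ ∧
    v = ν₂ * (2 * β - 1) + γ + 1 / c * Real.log (IPlus c γ ν₁ ν₂)}

/-- The infimum over `c > 0` of `-c/2 + I⁺_str(c, β) + I_sph(c, α)`. For `α > 0` and `β ≥ 0` it is
bounded below by `-√α`. -/
def liftedValue (α β : ℝ) : ℝ :=
  sInf {v : ℝ | ∃ c : ℝ, 0 < c ∧ v = -c / 2 + IStrPlus c β + ISph c α}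

end

end NonnegL1

open NonnegL1

/-! If recovery fails for `A`, the difference of a competitor and the true vector, normalized, is a
unit kernel vector with non-positive sum and at most `k` negative entries
(`exists_failureDirection`). So the task is to show that `‖A w‖` is rarely small on this set of
directions.

Gordon's comparison relates the processes `‖A w‖ + g₀` and `‖g‖ - ⟨h, w⟩`. It comes from
interpolating along a quarter circle and integrating by parts. What remains is a sum over pairs `w,
w'` with weights `1 - ⟨w, w'⟩`, which are non-negative on unit vectors and zero on the diagonal
(`trace_vectorProcess_le`, `gordon_measure_le`). The norm and the indicator are smoothed at scale
one, which is harmless because all relevant levels are of order `√n`.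

The lifting lies in the level `lam ≈ -c √n`. On the left, `g₀ ≤ -c √n` costs only `e^{-c² n / 2}`
and is independent of `A`; on the right, Markov's inequality with exponent `c √n` gains `e^{-c² n}`.
The quotient produces the term `-c / 2` (`gaussianMatrix_near_kernel_le`).

The rest of the right side splits by independence. The Laplace transform of `‖g‖` has exponential
rate `ISph`, since a norm is a minimum of quadratic functions whose Gaussian integrals are explicit
(`exists_integral_exp_neg_norm_le`). The maximum of `⟨h, w⟩` is bounded by Lagrangian duality by a
sum of functions `tPlus` of single coordinates (`sqrt_mul_inner_le`), so its exponential moment is a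
power of `IPlus`, computed by completing squares (`integral_exp_mul_tPlus`). -/

open MeasureTheory ProbabilityTheory

namespace NonnegL1

/-! ### The standard Gaussian measure on `ι → ℝ` -/

section GaussianPi

variable {ι : Type*} [Fintype ι]

/-- The law of a vector of i.i.d. standard normal variables. -/
noncomputable def gaussianPi (ι : Type*) [Fintype ι] : Measure (ι → ℝ) :=
  Measure.pi fun _ => gaussianReal 0 1

instance : IsProbabilityMeasure (gaussianPi ι) := by
  unfold gaussianPi; infer_instance

instance : IsGaussian (gaussianPi ι) := by
  have h : gaussianPi ι = (stdGaussian (EuclideanSpace ℝ ι)).map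
      (EuclideanSpace.equiv ι ℝ).toContinuousLinearMap := by
    rw [← map_pi_eq_stdGaussian, Measure.map_map (by fun_prop) (by fun_prop)]
    exact (Measure.map_id).symm
  rw [h]
  infer_instance

/-- The density of `gaussianPi`. -/
noncomputable def gaussianPiDensity (x : ι → ℝ) : ℝ := ∏ i, gaussianPDFReal 0 1 (x i)

lemma gaussianPiDensity_nonneg (x : ι → ℝ) : 0 ≤ gaussianPiDensity x :=
  Finset.prod_nonneg fun _ _ => gaussianPDFReal_nonneg _ _ _

lemma hasDerivAt_gaussianPDFReal (x : ℝ) :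
    HasDerivAt (gaussianPDFReal 0 1) (-x * gaussianPDFReal 0 1 x) x := by
  have h : HasDerivAt (fun y : ℝ => -(y - 0) ^ 2 / (2 * ((1 : NNReal) : ℝ))) (-x) x := by
    have := (((hasDerivAt_id' x).sub_const 0).fun_pow 2).fun_neg.div_const (2 * ((1 : NNReal) : ℝ))
    refine this.congr_deriv ?_
    push_cast
    ring
  rw [gaussianPDFReal_def]
  have := h.exp.const_mul (√(2 * Real.pi * ((1 : NNReal) : ℝ)))⁻¹
  refine this.congr_deriv ?_
  ring

lemma hasFDerivAt_gaussianPiDensity [DecidableEq ι] (x : ι → ℝ) :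
    HasFDerivAt gaussianPiDensity
      (∑ i, (-x i * gaussianPiDensity x) • ContinuousLinearMap.proj (R := ℝ) (φ := fun _ => ℝ) i)
      x := by
  have h := HasFDerivAt.finsetProd (u := Finset.univ)
    (g := fun (i : ι) (y : ι → ℝ) => gaussianPDFReal 0 1 (y i)) (x := x)
    (g' := fun i => (-x i * gaussianPDFReal 0 1 (x i)) •
      ContinuousLinearMap.proj (R := ℝ) (φ := fun _ => ℝ) i)
    (fun i _ => HasDerivAt.comp_hasFDerivAt (h₂ := gaussianPDFReal 0 1) (f := fun y : ι → ℝ => y i) x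
      (hasDerivAt_gaussianPDFReal (x i))
      (ContinuousLinearMap.proj (R := ℝ) (φ := fun _ => ℝ) i).hasFDerivAt)
  refine h.congr_fderiv (Finset.sum_congr rfl fun i _ => ?_)
  rw [smul_smul, gaussianPiDensity, ← Finset.mul_prod_erase _ _ (Finset.mem_univ i)]
  congr 1
  ring

lemma continuous_gaussianPiDensity : Continuous (gaussianPiDensity (ι := ι)) := by
  classical
  exact continuous_iff_continuousAt.2 fun x => (hasFDerivAt_gaussianPiDensity x).continuousAt

lemma gaussianPi_eq_withDensity :
    gaussianPi ι = volume.withDensity fun x => ENNReal.ofReal (gaussianPiDensity x) := by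
  refine Measure.pi_eq fun s hs => ?_
  rw [withDensity_apply _ (MeasurableSet.univ_pi hs), volume_pi, Measure.restrict_pi_pi,
    ← ofReal_integral_eq_lintegral_ofReal]
  · simp only [gaussianPiDensity]
    rw [integral_fintype_prod_eq_prod (fun _ => gaussianPDFReal 0 1),
      ENNReal.ofReal_prod_of_nonneg]
    · exact Finset.prod_congr rfl fun i _ =>
        (gaussianReal_apply_eq_integral 0 one_ne_zero (s i)).symm
    · exact fun i _ => integral_nonneg fun _ => gaussianPDFReal_nonneg _ _ _
  · exact Integrable.fintype_prod (f := fun _ => gaussianPDFReal 0 1)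
      fun i => (integrable_gaussianPDFReal 0 1).restrict
  · exact Filter.Eventually.of_forall gaussianPiDensity_nonneg

lemma integral_gaussianPi (f : (ι → ℝ) → ℝ) :
    ∫ x, f x ∂gaussianPi ι = ∫ x, gaussianPiDensity x * f x := by
  rw [gaussianPi_eq_withDensity, integral_withDensity_eq_integral_toReal_smul]
  · simp [ENNReal.toReal_ofReal (gaussianPiDensity_nonneg _)]
  · exact continuous_gaussianPiDensity.measurable.ennreal_ofReal
  · simp

lemma integrable_gaussianPi_iff {f : (ι → ℝ) → ℝ} :
    Integrable f (gaussianPi ι) ↔ Integrable fun x => gaussianPiDensity x * f x := by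
  rw [gaussianPi_eq_withDensity, integrable_withDensity_iff_integrable_smul']
  · simp [ENNReal.toReal_ofReal (gaussianPiDensity_nonneg _)]
  · exact continuous_gaussianPiDensity.measurable.ennreal_ofReal
  · simp

lemma integrable_one_add_norm_pow (k : ℕ) :
    Integrable (fun x : ι → ℝ => (1 + ‖x‖) ^ k) (gaussianPi ι) := by
  rcases eq_or_ne k 0 with rfl | hk
  · simp
  have h0 : MemLp (fun x : ι → ℝ => ‖x‖) k (gaussianPi ι) :=
    (IsGaussian.memLp_id (gaussianPi ι) k (ENNReal.natCast_ne_top k)).norm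
  have h1 : MemLp (fun _ : ι → ℝ => (1 : ℝ)) k (gaussianPi ι) := memLp_const 1
  have h : MemLp (fun x : ι → ℝ => 1 + ‖x‖) k (gaussianPi ι) := h1.add h0
  refine (h.integrable_norm_pow hk).congr (Filter.Eventually.of_forall fun x => ?_)
  change ‖1 + ‖x‖‖ ^ k = _
  rw [Real.norm_of_nonneg (by positivity)]

/-- A Gaussian measure has all moments. Temperate growth is stable under products, derivatives and
composition with linear maps, so it settles every integrability question of the interpolation. -/
lemma _root_.Function.HasTemperateGrowth.integrable_gaussianPi {f : (ι → ℝ) → ℝ}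
    (hf : f.HasTemperateGrowth) : Integrable f (gaussianPi ι) := by
  obtain ⟨k, C, h⟩ := hf.2 0
  refine ((integrable_one_add_norm_pow k).const_mul C).mono'
    hf.1.continuous.aestronglyMeasurable (Filter.Eventually.of_forall fun x => ?_)
  simpa using h x

lemma _root_.Function.HasTemperateGrowth.fderiv {E F : Type*} [NormedAddCommGroup E]
    [NormedSpace ℝ E] [NormedAddCommGroup F] [NormedSpace ℝ F] {f : E → F}
    (hf : f.HasTemperateGrowth) : (fderiv ℝ f).HasTemperateGrowth := by
  refine ⟨(contDiff_infty_iff_fderiv.1 hf.1).2, fun n => ?_⟩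
  obtain ⟨k, C, h⟩ := hf.2 (n + 1)
  exact ⟨k, C, fun x => by rw [norm_iteratedFDeriv_fderiv]; exact h x⟩

lemma _root_.Function.HasTemperateGrowth.fderiv_apply {E F : Type*} [NormedAddCommGroup E]
    [NormedSpace ℝ E] [NormedAddCommGroup F] [NormedSpace ℝ F] {f : E → F}
    (hf : f.HasTemperateGrowth) (v : E) : (fun x => fderiv ℝ f x v).HasTemperateGrowth :=
  (ContinuousLinearMap.apply ℝ F v).hasTemperateGrowth.comp hf.fderiv

/-- **Stein's lemma** (Gaussian integration by parts). -/
lemma integral_coord_mul_gaussianPi [DecidableEq ι] {f : (ι → ℝ) → ℝ}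
    (hf : f.HasTemperateGrowth) (i : ι) :
    ∫ x, x i * f x ∂gaussianPi ι = ∫ x, fderiv ℝ f x (Pi.single i 1) ∂gaussianPi ι := by
  have hcoord : (fun x : ι → ℝ => x i * f x).HasTemperateGrowth :=
    ((ContinuousLinearMap.proj (R := ℝ) (φ := fun _ : ι => ℝ) i).hasTemperateGrowth).mul hf
  have key (x : ι → ℝ) :
      (∑ j, (-x j * gaussianPiDensity x) •
        ContinuousLinearMap.proj (R := ℝ) (φ := fun _ => ℝ) j) (Pi.single i (1 : ℝ))
      = -(x i * gaussianPiDensity x) := by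
    simp [Pi.single_apply]
  have h := integral_bilinear_hasFDerivAt_right_eq_neg_left_of_integrable
    (μ := (volume : Measure (ι → ℝ))) (B := ContinuousLinearMap.mul ℝ ℝ)
    (f := f) (f' := fun x => fderiv ℝ f x) (g := gaussianPiDensity)
    (g' := fun x => ∑ i, (-x i * gaussianPiDensity x) •
        ContinuousLinearMap.proj (R := ℝ) (φ := fun _ => ℝ) i) (v := Pi.single i 1)
    ?_ ?_ ?_ (fun x _ => (hf.1.differentiable (by simp) x).hasFDerivAt)
    (fun x _ => hasFDerivAt_gaussianPiDensity x)
  · rw [integral_gaussianPi, integral_gaussianPi]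
    simp only [key, ContinuousLinearMap.mul_apply'] at h
    rw [← neg_inj, ← integral_neg]
    convert h using 1
    · congr 1; ext x; ring
    · congr 2; ext x; ring
  · simp only [ContinuousLinearMap.mul_apply']
    refine (integrable_gaussianPi_iff.1 (hf.fderiv_apply (Pi.single i 1)).integrable_gaussianPi).congr
      (Filter.Eventually.of_forall fun x => mul_comm _ _)
  · simp only [key, ContinuousLinearMap.mul_apply']
    refine (integrable_gaussianPi_iff.1 hcoord.neg.integrable_gaussianPi).congr
      (Filter.Eventually.of_forall fun x => ?_)
    simp only [Pi.neg_apply]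
    ring
  · simp only [ContinuousLinearMap.mul_apply']
    exact (integrable_gaussianPi_iff.1 hf.integrable_gaussianPi).congr
      (Filter.Eventually.of_forall fun x => mul_comm _ _)

end GaussianPi

/-! ### Gaussian interpolation -/

section Interpolation

variable {ι : Type*} [Fintype ι]
  {E : Type*} [NormedAddCommGroup E] [NormedSpace ℝ E]

/-- Integration by parts for the directional derivative of `F ∘ Z` along a linear field `T`. -/
lemma integral_fderiv_comp_gaussianPi [DecidableEq ι] {F : E → ℝ} (hF : F.HasTemperateGrowth)
    (Z T : (ι → ℝ) →L[ℝ] E) :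
    ∫ x, fderiv ℝ F (Z x) (T x) ∂gaussianPi ι =
      ∫ x, ∑ i, fderiv ℝ (fun z => fderiv ℝ F z (T (Pi.single i 1))) (Z x) (Z (Pi.single i 1))
        ∂gaussianPi ι := by
  have hg (i : ι) : (fun x => fderiv ℝ F (Z x) (T (Pi.single i 1))).HasTemperateGrowth :=
    (hF.fderiv_apply (T (Pi.single i 1))).comp Z.hasTemperateGrowth
  have hT (x : ι → ℝ) : T x = ∑ i, x i • T (Pi.single i 1) := by
    conv_lhs => rw [← Finset.univ_sum_single x]
    rw [map_sum]
    refine Finset.sum_congr rfl fun i _ => ?_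
    rw [← map_smul, ← Pi.single_smul, smul_eq_mul, mul_one]
  have hder (i : ι) (x : ι → ℝ) :
      fderiv ℝ (fun x => fderiv ℝ F (Z x) (T (Pi.single i 1))) x (Pi.single i 1) =
      fderiv ℝ (fun z => fderiv ℝ F z (T (Pi.single i 1))) (Z x) (Z (Pi.single i 1)) := by
    have h := ((hF.fderiv_apply (T (Pi.single i 1))).1.differentiable (by simp)
      (Z x)).hasFDerivAt.comp x Z.hasFDerivAt
    have h2 : fderiv ℝ (fun x => fderiv ℝ F (Z x) (T (Pi.single i 1))) x = _ := h.fderiv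
    rw [h2]
    rfl
  have hc (i : ι) : (fun x : ι → ℝ => x i * fderiv ℝ F (Z x) (T (Pi.single i 1))).HasTemperateGrowth :=
    ((ContinuousLinearMap.proj (R := ℝ) (φ := fun _ : ι => ℝ) i).hasTemperateGrowth).mul (hg i)
  calc ∫ x, fderiv ℝ F (Z x) (T x) ∂gaussianPi ι
      = ∫ x, ∑ i, x i * fderiv ℝ F (Z x) (T (Pi.single i 1)) ∂gaussianPi ι := by
        congr 1
        ext x
        rw [hT x, map_sum]
        simp only [map_smul, smul_eq_mul]
    _ = ∑ i, ∫ x, x i * fderiv ℝ F (Z x) (T (Pi.single i 1)) ∂gaussianPi ι :=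
        integral_finsetSum _ fun i _ => (hc i).integrable_gaussianPi
    _ = ∑ i, ∫ x, fderiv ℝ (fun z => fderiv ℝ F z (T (Pi.single i 1))) (Z x) (Z (Pi.single i 1))
        ∂gaussianPi ι := by
        refine Finset.sum_congr rfl fun i _ => ?_
        rw [integral_coord_mul_gaussianPi (hg i) i]
        simp only [hder]
    _ = _ := by
        refine (integral_finsetSum _ fun i _ => ?_).symm
        have := ((hg i).fderiv_apply (Pi.single i 1)).integrable_gaussianPi
        simpa only [hder] using this

/-- The interpolation between `M` and `L` along the quarter circle. -/
noncomputable def interp (L M : (ι → ℝ) →L[ℝ] E) (θ : ℝ) : (ι → ℝ) →L[ℝ] E :=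
  Real.sin θ • L + Real.cos θ • M

/-- The velocity of `interp`. -/
noncomputable def interpVel (L M : (ι → ℝ) →L[ℝ] E) (θ : ℝ) : (ι → ℝ) →L[ℝ] E :=
  Real.cos θ • L - Real.sin θ • M


/-- Differentiation under the integral: temperate growth of `fderiv ℝ F` gives a domination by a
power of `1 + ‖x‖`, uniform in `θ` because sine and cosine are bounded by one. -/
lemma hasDerivAt_integral_interp {F : E → ℝ} (hF : F.HasTemperateGrowth)
    (L M : (ι → ℝ) →L[ℝ] E) (θ : ℝ) :
    HasDerivAt (fun θ => ∫ x, F (interp L M θ x) ∂gaussianPi ι)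
      (∫ x, fderiv ℝ F (interp L M θ x) (interpVel L M θ x) ∂gaussianPi ι) θ := by
  obtain ⟨k, C, hC⟩ := hF.fderiv.2 0
  set R : ℝ := ‖L‖ + ‖M‖
  have hR : 0 ≤ R := by positivity
  have hC0 : 0 ≤ C := by
    have := (norm_nonneg _).trans (hC 0)
    simpa using this
  have hcomb (a b : ℝ) (ha : |a| ≤ 1) (hb : |b| ≤ 1) (x : ι → ℝ) :
      ‖a • L x‖ + ‖b • M x‖ ≤ R * ‖x‖ := by
    rw [norm_smul, norm_smul, Real.norm_eq_abs, Real.norm_eq_abs, add_mul]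
    have h1 := L.le_opNorm x
    have h2 := M.le_opNorm x
    have h3 : |a| * ‖L x‖ ≤ ‖L x‖ := mul_le_of_le_one_left (norm_nonneg _) ha
    have h4 : |b| * ‖M x‖ ≤ ‖M x‖ := mul_le_of_le_one_left (norm_nonneg _) hb
    linarith
  have hZ (θ : ℝ) (x : ι → ℝ) : ‖interp L M θ x‖ ≤ R * ‖x‖ :=
    (norm_add_le _ _).trans (hcomb _ _ (Real.abs_sin_le_one θ) (Real.abs_cos_le_one θ) x)
  have hV (θ : ℝ) (x : ι → ℝ) : ‖interpVel L M θ x‖ ≤ R * ‖x‖ :=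
    (norm_sub_le _ _).trans (hcomb _ _ (Real.abs_cos_le_one θ) (Real.abs_sin_le_one θ) x)
  have hcont (θ : ℝ) : Continuous fun x => F (interp L M θ x) :=
    hF.1.continuous.comp (interp L M θ).continuous
  refine (hasDerivAt_integral_of_dominated_loc_of_deriv_le (μ := gaussianPi ι)
    (F := fun θ x => F (interp L M θ x))
    (F' := fun θ x => fderiv ℝ F (interp L M θ x) (interpVel L M θ x))
    (bound := fun x => C * (1 + R) ^ k * R * (1 + ‖x‖) ^ (k + 1))
    Filter.univ_mem (Filter.Eventually.of_forall fun θ => (hcont θ).aestronglyMeasurable)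
    (hF.comp (interp L M θ).hasTemperateGrowth).integrable_gaussianPi
    ?_ (Filter.Eventually.of_forall fun x θ _ => ?_)
    ((integrable_one_add_norm_pow (k + 1)).const_mul _)
    (Filter.Eventually.of_forall fun x θ _ => ?_)).2
  · exact ((hF.fderiv.1.continuous.comp (interp L M θ).continuous).clm_apply
      (interpVel L M θ).continuous).aestronglyMeasurable
  · calc ‖fderiv ℝ F (interp L M θ x) (interpVel L M θ x)‖
        ≤ ‖fderiv ℝ F (interp L M θ x)‖ * ‖interpVel L M θ x‖ := ContinuousLinearMap.le_opNorm _ _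
      _ ≤ (C * (1 + R * ‖x‖) ^ k) * (R * ‖x‖) := by
          have h1 : ‖fderiv ℝ F (interp L M θ x)‖ ≤ C * (1 + ‖interp L M θ x‖) ^ k := by
            simpa using hC (interp L M θ x)
          have h2 := hZ θ x
          have h3 := hV θ x
          gcongr
          refine h1.trans ?_
          gcongr
      _ ≤ (C * ((1 + R) * (1 + ‖x‖)) ^ k) * (R * (1 + ‖x‖)) := by
          gcongr
          · nlinarith [norm_nonneg x]
          · linarith
      _ = _ := by rw [mul_pow, pow_succ]; ring
  · have h1 : HasDerivAt (fun θ => interp L M θ x) (interpVel L M θ x) θ := by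
      have h := ((Real.hasDerivAt_sin θ).smul_const (L x)).add
        ((Real.hasDerivAt_cos θ).smul_const (M x))
      refine h.congr_deriv ?_
      simp [interpVel, sub_eq_add_neg]
    exact ((hF.1.differentiable (by simp) _).hasFDerivAt).comp_hasDerivAt θ h1

/-- **Gaussian comparison by interpolation**: if `L` and `M` depend on disjoint sets of coordinates
and the second derivatives of `F` contracted with the covariance of `L` dominate those contracted
with the covariance of `M`, then `E F(M) ≤ E F(L)`. -/
theorem integral_comp_le_of_trace_le [DecidableEq ι] {F : E → ℝ} (hF : F.HasTemperateGrowth)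
    (L M : (ι → ℝ) →L[ℝ] E)
    (hdisj : ∀ i, L (Pi.single i 1) = 0 ∨ M (Pi.single i 1) = 0)
    (htrace : ∀ z,
      ∑ i, fderiv ℝ (fun z => fderiv ℝ F z (M (Pi.single i 1))) z (M (Pi.single i 1)) ≤
      ∑ i, fderiv ℝ (fun z => fderiv ℝ F z (L (Pi.single i 1))) z (L (Pi.single i 1))) :
    ∫ x, F (M x) ∂gaussianPi ι ≤ ∫ x, F (L x) ∂gaussianPi ι := by
  have hd := hasDerivAt_integral_interp hF L M
  have hmono : MonotoneOn (fun θ => ∫ x, F (interp L M θ x) ∂gaussianPi ι)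
      (Set.Icc 0 (Real.pi / 2)) := by
    refine monotoneOn_of_deriv_nonneg (convex_Icc _ _)
      (fun θ _ => (hd θ).continuousAt.continuousWithinAt)
      (fun θ _ => (hd θ).differentiableAt.differentiableWithinAt) fun θ hθ => ?_
    rw [interior_Icc] at hθ
    have hs : 0 ≤ Real.sin θ := Real.sin_nonneg_of_nonneg_of_le_pi hθ.1.le
      (by linarith [hθ.2, Real.pi_pos])
    have hc : 0 ≤ Real.cos θ := Real.cos_nonneg_of_mem_Icc ⟨by linarith [hθ.1, Real.pi_pos], hθ.2.le⟩
    rw [(hd θ).deriv, integral_fderiv_comp_gaussianPi hF]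
    refine integral_nonneg fun x => ?_
    have hsmul (a : ℝ) (v w z : E) : fderiv ℝ (fun z => fderiv ℝ F z (a • v)) z w =
        a * fderiv ℝ (fun z => fderiv ℝ F z v) z w := by
      simp only [map_smul]
      rw [fderiv_fun_const_smul ((hF.fderiv_apply v).1.differentiable (by simp) z)]
      rfl
    have hterm (i : ι) :
        fderiv ℝ (fun z => fderiv ℝ F z (interpVel L M θ (Pi.single i 1))) (interp L M θ x)
          (interp L M θ (Pi.single i 1)) = Real.sin θ * Real.cos θ *
        (fderiv ℝ (fun z => fderiv ℝ F z (L (Pi.single i 1))) (interp L M θ x) (L (Pi.single i 1))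
        - fderiv ℝ (fun z => fderiv ℝ F z (M (Pi.single i 1))) (interp L M θ x)
          (M (Pi.single i 1))) := by
      have h1 : interp L M θ (Pi.single i 1) =
        Real.sin θ • L (Pi.single i 1) + Real.cos θ • M (Pi.single i 1) := rfl
      have h2 : interpVel L M θ (Pi.single i 1) =
        Real.cos θ • L (Pi.single i 1) - Real.sin θ • M (Pi.single i 1) := rfl
      -- In each coordinate direction one of `L`, `M` vanishes, so there are no mixed terms;
      -- velocity times position leaves `sin θ cos θ` with a plus sign for `L` and a minus sign for
      -- `M`.
      rcases hdisj i with h | h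
      · rw [h1, h2, h, smul_zero, zero_sub, smul_zero, zero_add, ← neg_smul, hsmul, map_smul,
          smul_eq_mul, map_zero]
        ring
      · rw [h1, h2, h, smul_zero, sub_zero, smul_zero, add_zero, hsmul, map_smul,
          smul_eq_mul, map_zero]
        ring
    simp only [Pi.zero_apply, hterm]
    rw [← Finset.mul_sum, Finset.sum_sub_distrib]
    exact mul_nonneg (mul_nonneg hs hc) (sub_nonneg.2 (htrace _))
  have h := hmono (Set.left_mem_Icc.2 (by positivity)) (Set.right_mem_Icc.2 (by positivity))
    (by positivity : (0 : ℝ) ≤ Real.pi / 2)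
  simpa [interp] using h

end Interpolation

/-! ### Second derivatives of a product function -/

section ProductFunction

variable {W P : Type*} [Fintype W] [NormedAddCommGroup P] [NormedSpace ℝ P]

/-- The coefficients of the Hessian of `z ↦ ∏ w, ρ (z w)`. -/
noncomputable def prodHess [DecidableEq W] (ρ : P → ℝ) (z : W → P) (w w' : W) (p q : P) : ℝ :=
  if w' = w then (∏ v ∈ Finset.univ.erase w, ρ (z v)) *
      fderiv ℝ (fun x => fderiv ℝ ρ x p) (z w) q
  else (∏ v ∈ (Finset.univ.erase w).erase w', ρ (z v)) *
      (fderiv ℝ ρ (z w') q * fderiv ℝ ρ (z w) p)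

lemma hasFDerivAt_comp_proj {g : P → ℝ} (hg : Differentiable ℝ g) (z : W → P) (w : W) :
    HasFDerivAt (fun z : W → P => g (z w))
      ((fderiv ℝ g (z w)).comp (ContinuousLinearMap.proj (R := ℝ) (φ := fun _ : W => P) w)) z :=
  (hg (z w)).hasFDerivAt.comp z
    (ContinuousLinearMap.proj (R := ℝ) (φ := fun _ : W => P) w).hasFDerivAt

lemma fderiv_prod_apply [DecidableEq W] {ρ : P → ℝ} (hρ : Differentiable ℝ ρ) (z a : W → P) :
    fderiv ℝ (fun z : W → P => ∏ w, ρ (z w)) z a =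
      ∑ w, (∏ v ∈ Finset.univ.erase w, ρ (z v)) * fderiv ℝ ρ (z w) (a w) := by
  rw [(HasFDerivAt.finsetProd fun w _ => hasFDerivAt_comp_proj hρ z w).fderiv]
  simp

lemma fderiv_fderiv_prod_apply [DecidableEq W] {ρ : P → ℝ} (hρ : ρ.HasTemperateGrowth) (z a : W → P) :
    fderiv ℝ (fun z => fderiv ℝ (fun z : W → P => ∏ w, ρ (z w)) z a) z a =
      ∑ w, ∑ w', prodHess ρ z w w' (a w) (a w') := by
  have hd : Differentiable ℝ ρ := hρ.1.differentiable (by simp)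
  simp only [fderiv_prod_apply hd]
  have h (w : W) := (HasFDerivAt.finsetProd (u := Finset.univ.erase w) fun v _ =>
    hasFDerivAt_comp_proj hd z v).mul
      (hasFDerivAt_comp_proj ((hρ.fderiv_apply (a w)).1.differentiable (by simp)) z w)
  have h2 := HasFDerivAt.fun_sum (u := Finset.univ) fun w _ => h w
  rw [show fderiv ℝ (fun z => ∑ w, (∏ v ∈ Finset.univ.erase w, ρ (z v)) *
    fderiv ℝ ρ (z w) (a w)) z = _ from h2.fderiv, sum_apply]
  refine Finset.sum_congr rfl fun w _ => ?_
  rw [← Finset.add_sum_erase _ _ (Finset.mem_univ w)]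
  simp only [add_apply, smul_apply, smul_eq_mul, sum_apply,
    ContinuousLinearMap.comp_apply, ContinuousLinearMap.proj_apply]
  congr 1
  · simp [prodHess]
  · rw [Finset.mul_sum]
    refine Finset.sum_congr rfl fun w' hw' => ?_
    rw [prodHess, if_neg (Finset.ne_of_mem_erase hw')]
    ring

lemma prodHess_smul [DecidableEq W] {ρ : P → ℝ} (hρ : ρ.HasTemperateGrowth) (z : W → P) (w w' : W) (p : P)
    (s t : ℝ) : prodHess ρ z w w' (s • p) (t • p) = s * t * prodHess ρ z w w' p p := by
  unfold prodHess
  split_ifs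
  · simp only [map_smul, smul_eq_mul]
    rw [fderiv_const_mul ((hρ.fderiv_apply p).1.differentiable (by simp) _)]
    simp only [smul_apply, smul_eq_mul]
    ring
  · simp only [map_smul, smul_eq_mul]
    ring

/-- Each Gaussian coordinate moves all the points `z w` along one common vector `p`. Summing the
weights `s w * s w'` over the coordinates then yields covariances. -/
lemma fderiv_fderiv_prod_smul [DecidableEq W] {ρ : P → ℝ} (hρ : ρ.HasTemperateGrowth) (z : W → P) (s : W → ℝ)
    (p : P) :
    fderiv ℝ (fun z => fderiv ℝ (fun z : W → P => ∏ w, ρ (z w)) z fun w => s w • p) z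
        (fun w => s w • p) =
      ∑ w, ∑ w', s w * s w' * prodHess ρ z w w' p p := by
  rw [fderiv_fderiv_prod_apply hρ]
  simp only [prodHess_smul hρ]

lemma hasTemperateGrowth_prod {ρ : P → ℝ} (hρ : ρ.HasTemperateGrowth) :
    (fun z : W → P => ∏ w, ρ (z w)).HasTemperateGrowth := by
  classical
  have h (s : Finset W) : (fun z : W → P => ∏ w ∈ s, ρ (z w)).HasTemperateGrowth := by
    induction s using Finset.induction_on with
    | empty => simp
    | insert a s has ih =>
      simp only [Finset.prod_insert has]
      exact (hρ.comp (ContinuousLinearMap.proj (R := ℝ) (φ := fun _ : W => P) a).hasTemperateGrowth).mul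
        ih
  exact h _

end ProductFunction

/-! ### The smooth cutoff of `‖v‖ + s` -/

section Cutoff

variable {m : ℕ}

/-- The function is bounded and its derivative is smooth with support in `[0, 1]`. -/
lemma smoothTransition_hasTemperateGrowth : Real.smoothTransition.HasTemperateGrowth := by
  have hc : ContDiff ℝ (⊤ : ℕ∞) Real.smoothTransition := Real.smoothTransition.contDiff
  refine Function.HasTemperateGrowth.of_fderiv (k := 0) (C := 1)
    (HasCompactSupport.hasTemperateGrowth ?_ (contDiff_infty_iff_fderiv.1 hc).2)
    (hc.differentiable (by simp)) fun x => ?_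
  · refine HasCompactSupport.intro (isCompact_Icc (a := (0 : ℝ)) (b := 1)) fun x hx => ?_
    rcases not_and_or.1 hx with h | h
    · rw [Filter.EventuallyEq.fderiv_eq (f := fun _ => (0 : ℝ))]
      · simp
      · filter_upwards [Iio_mem_nhds (not_le.1 h)] with y hy
        exact Real.smoothTransition.zero_of_nonpos (le_of_lt hy)
    · rw [Filter.EventuallyEq.fderiv_eq (f := fun _ => (1 : ℝ))]
      · simp
      · filter_upwards [Ioi_mem_nhds (not_le.1 h)] with y hy
        exact Real.smoothTransition.one_of_one_le (le_of_lt hy)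
  · simpa using abs_le.2 ⟨by linarith [Real.smoothTransition.nonneg x],
      Real.smoothTransition.le_one x⟩

/-- The smoothed version of `‖v‖ + s`. -/
noncomputable def softVal (p : EuclideanSpace ℝ (Fin m) × ℝ) : ℝ := √(1 + ‖p.1‖ ^ 2) + p.2

/-- A smooth function that vanishes where `softVal p ≤ lam` and equals `1` where
`lam + 1 ≤ softVal p`. -/
noncomputable def cutoff (lam : ℝ) (p : EuclideanSpace ℝ (Fin m) × ℝ) : ℝ :=
  Real.smoothTransition (softVal p - lam)

lemma softVal_hasTemperateGrowth :
    (softVal : EuclideanSpace ℝ (Fin m) × ℝ → ℝ).HasTemperateGrowth := by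
  have h := (Function.hasTemperateGrowth_one_add_norm_sq_rpow
    (EuclideanSpace ℝ (Fin m)) (1 / 2)).comp
    (ContinuousLinearMap.fst ℝ (EuclideanSpace ℝ (Fin m)) ℝ).hasTemperateGrowth
  have h2 := h.add (ContinuousLinearMap.snd ℝ (EuclideanSpace ℝ (Fin m)) ℝ).hasTemperateGrowth
  refine (funext fun p => ?_ : softVal = _) ▸ h2
  simp [softVal, Real.sqrt_eq_rpow]

lemma cutoff_hasTemperateGrowth (lam : ℝ) :
    (cutoff lam : EuclideanSpace ℝ (Fin m) × ℝ → ℝ).HasTemperateGrowth :=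
  smoothTransition_hasTemperateGrowth.comp
    (softVal_hasTemperateGrowth.sub (Function.HasTemperateGrowth.const lam))

lemma cutoff_nonneg (lam : ℝ) (p : EuclideanSpace ℝ (Fin m) × ℝ) : 0 ≤ cutoff lam p :=
  Real.smoothTransition.nonneg _

lemma cutoff_le_one (lam : ℝ) (p : EuclideanSpace ℝ (Fin m) × ℝ) : cutoff lam p ≤ 1 :=
  Real.smoothTransition.le_one _

lemma hasFDerivAt_softVal (p : EuclideanSpace ℝ (Fin m) × ℝ) :
    HasFDerivAt softVal ((√(1 + ‖p.1‖ ^ 2))⁻¹ • (innerSL ℝ p.1).comp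
      (ContinuousLinearMap.fst ℝ (EuclideanSpace ℝ (Fin m)) ℝ) +
      ContinuousLinearMap.snd ℝ (EuclideanSpace ℝ (Fin m)) ℝ) p := by
  have h1 : HasFDerivAt (fun p : EuclideanSpace ℝ (Fin m) × ℝ => 1 + ‖p.1‖ ^ 2)
      ((2 • innerSL ℝ p.1).comp (ContinuousLinearMap.fst ℝ (EuclideanSpace ℝ (Fin m)) ℝ)) p :=
    ((hasStrictFDerivAt_norm_sq p.1).hasFDerivAt.comp p hasFDerivAt_fst).const_add 1
  have h2 := (h1.sqrt (by positivity)).add (hasFDerivAt_snd (p := p) (𝕜 := ℝ))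
  refine h2.congr_fderiv ?_
  ext v
  all_goals simp
  field_simp

lemma fderiv_cutoff_apply (lam : ℝ) (p q : EuclideanSpace ℝ (Fin m) × ℝ) :
    fderiv ℝ (cutoff lam) p q = deriv Real.smoothTransition (softVal p - lam) *
      ((√(1 + ‖p.1‖ ^ 2))⁻¹ * inner ℝ p.1 q.1 + q.2) := by
  have hd : HasDerivAt Real.smoothTransition (deriv Real.smoothTransition (softVal p - lam))
      (softVal p - lam) :=
    ((Real.smoothTransition.contDiff (n := 1)).differentiable (by simp) _).hasDerivAt
  have h := hd.comp_hasFDerivAt p ((hasFDerivAt_softVal p).sub_const lam)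
  rw [show fderiv ℝ (cutoff lam) p = _ from h.fderiv]
  simp only [add_apply, smul_apply, smul_eq_mul, ContinuousLinearMap.comp_apply,
    ContinuousLinearMap.coe_fst', ContinuousLinearMap.coe_snd', innerSL_apply_apply]

lemma deriv_smoothTransition_nonneg (x : ℝ) : 0 ≤ deriv Real.smoothTransition x :=
  Real.smoothTransition.monotone.deriv_nonneg

/-- The gradients of `softVal` in the first variable have norm less than one. -/
lemma sum_fderiv_cutoff_mul_le (lam : ℝ) (p q : EuclideanSpace ℝ (Fin m) × ℝ) :
    ∑ j, fderiv ℝ (cutoff lam) p (EuclideanSpace.single j 1, 0) *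
        fderiv ℝ (cutoff lam) q (EuclideanSpace.single j 1, 0) ≤
      fderiv ℝ (cutoff lam) p (0, 1) * fderiv ℝ (cutoff lam) q (0, 1) := by
  simp only [fderiv_cutoff_apply, add_zero, inner_zero_right, mul_zero, zero_add, mul_one]
  set a := deriv Real.smoothTransition (softVal p - lam)
  set b := deriv Real.smoothTransition (softVal q - lam)
  have ha : 0 ≤ a := deriv_smoothTransition_nonneg _
  have hb : 0 ≤ b := deriv_smoothTransition_nonneg _
  have hN (v : EuclideanSpace ℝ (Fin m)) : ‖v‖ ≤ √(1 + ‖v‖ ^ 2) :=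
    Real.le_sqrt_of_sq_le (by linarith)
  have h0 (v : EuclideanSpace ℝ (Fin m)) : 0 < √(1 + ‖v‖ ^ 2) := Real.sqrt_pos.2 (by positivity)
  have hsum : ∑ j, a * ((√(1 + ‖p.1‖ ^ 2))⁻¹ * inner ℝ p.1 (EuclideanSpace.single j (1 : ℝ))) *
      (b * ((√(1 + ‖q.1‖ ^ 2))⁻¹ * inner ℝ q.1 (EuclideanSpace.single j (1 : ℝ)))) =
      a * b * (inner ℝ p.1 q.1 / (√(1 + ‖p.1‖ ^ 2) * √(1 + ‖q.1‖ ^ 2))) := by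
    rw [PiLp.inner_apply, Finset.sum_div, Finset.mul_sum]
    refine Finset.sum_congr rfl fun j _ => ?_
    simp only [EuclideanSpace.inner_single_right, RCLike.inner_apply, conj_trivial]
    field_simp
  rw [hsum]
  refine mul_le_of_le_one_right (mul_nonneg ha hb) ?_
  rw [div_le_one (mul_pos (h0 _) (h0 _))]
  exact (real_inner_le_norm _ _).trans
    (mul_le_mul (hN _) (hN _) (norm_nonneg _) (h0 _).le)

end Cutoff

/-! ### The comparison of `‖A u‖ + g` with `‖g‖ - ⟨h, u⟩` -/

section Gordon

variable {m n : ℕ} {W : Type*}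

/-- Index set of the coordinates of `((A, g₀), (g, h))`. -/
abbrev GordonIndex (m n : ℕ) : Type := ((Fin m × Fin n) ⊕ Unit) ⊕ (Fin m ⊕ Fin n)

/-- `w ↦ (A u_w, g₀)`. -/
noncomputable def matrixProcess (u : W → Fin n → ℝ) :
    (GordonIndex m n → ℝ) →L[ℝ] (W → EuclideanSpace ℝ (Fin m) × ℝ) :=
  LinearMap.toContinuousLinearMap
    { toFun := fun x w => (WithLp.toLp 2 fun j => ∑ k, u w k * x (.inl (.inl (j, k))),
        x (.inl (.inr ())))
      map_add' := fun x y => by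
        ext w : 1
        ext j <;> simp [mul_add, Finset.sum_add_distrib]
      map_smul' := fun c x => by
        ext w : 1
        ext j <;> simp [Finset.mul_sum, mul_left_comm] }

/-- `w ↦ (g, -⟨h, u_w⟩)`. -/
noncomputable def vectorProcess (u : W → Fin n → ℝ) :
    (GordonIndex m n → ℝ) →L[ℝ] (W → EuclideanSpace ℝ (Fin m) × ℝ) :=
  LinearMap.toContinuousLinearMap
    { toFun := fun x w => (WithLp.toLp 2 fun j => x (.inr (.inl j)),
        -∑ k, u w k * x (.inr (.inr k)))
      map_add' := fun x y => by
        ext w : 1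
        ext j <;> simp [mul_add, Finset.sum_add_distrib]
        ring
      map_smul' := fun c x => by
        ext w : 1
        ext j <;> simp [Finset.mul_sum, mul_left_comm] }

lemma matrixProcess_apply (u : W → Fin n → ℝ) (x : GordonIndex m n → ℝ) (w : W) :
    matrixProcess u x w = (WithLp.toLp 2 fun j => ∑ k, u w k * x (.inl (.inl (j, k))),
        x (.inl (.inr ()))) := rfl

lemma vectorProcess_apply (u : W → Fin n → ℝ) (x : GordonIndex m n → ℝ) (w : W) :
    vectorProcess u x w = (WithLp.toLp 2 fun j => x (.inr (.inl j)),
        -∑ k, u w k * x (.inr (.inr k))) := rfl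

lemma matrixProcess_single_entry (u : W → Fin n → ℝ) (j : Fin m) (k : Fin n) :
    matrixProcess (m := m) u (Pi.single (.inl (.inl (j, k))) 1) =
      fun w => u w k • (EuclideanSpace.single j (1 : ℝ), (0 : ℝ)) := by
  ext w : 1
  rw [matrixProcess_apply]
  ext i
  · simp [Pi.single_apply, ite_and]
  · simp

lemma matrixProcess_single_unit (u : W → Fin n → ℝ) :
    matrixProcess (m := m) u (Pi.single (.inl (.inr ())) 1) =
      fun _ => (1 : ℝ) • ((0 : EuclideanSpace ℝ (Fin m)), (1 : ℝ)) := by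
  ext w : 1
  rw [matrixProcess_apply]
  ext i <;> simp

lemma matrixProcess_single_inr (u : W → Fin n → ℝ) (i : Fin m ⊕ Fin n) :
    matrixProcess (m := m) u (Pi.single (.inr i) 1) = 0 := by
  ext w : 1
  rw [matrixProcess_apply]
  ext i <;> simp

lemma vectorProcess_single_left (u : W → Fin n → ℝ) (j : Fin m) :
    vectorProcess u (Pi.single (.inr (.inl j)) 1) =
      fun _ => (1 : ℝ) • (EuclideanSpace.single j (1 : ℝ), (0 : ℝ)) := by
  ext w : 1
  rw [vectorProcess_apply]
  ext i <;> simp [Pi.single_apply]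

lemma vectorProcess_single_right (u : W → Fin n → ℝ) (k : Fin n) :
    vectorProcess (m := m) u (Pi.single (.inr (.inr k)) 1) =
      fun w => (-u w k) • ((0 : EuclideanSpace ℝ (Fin m)), (1 : ℝ)) := by
  ext w : 1
  rw [vectorProcess_apply]
  ext i <;> simp [Pi.single_apply]

lemma vectorProcess_single_inl (u : W → Fin n → ℝ) (i : (Fin m × Fin n) ⊕ Unit) :
    vectorProcess (m := m) u (Pi.single (.inl i) 1) = 0 := by
  ext w : 1
  rw [vectorProcess_apply]
  ext i <;> simp

lemma sum_mul_le_one {u v : Fin n → ℝ} (hu : ∑ k, u k ^ 2 = 1) (hv : ∑ k, v k ^ 2 = 1) :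
    ∑ k, u k * v k ≤ 1 := by
  have h : ∑ k, u k * v k ≤ ∑ k, (u k ^ 2 + v k ^ 2) / 2 :=
    Finset.sum_le_sum fun k _ => by nlinarith [sq_nonneg (u k - v k)]
  rw [← Finset.sum_div, Finset.sum_add_distrib, hu, hv] at h
  linarith

/-- In the matrix process the vector part has covariance `⟨u_w, u_w'⟩` and the scalar part
covariance `1`; in the vector process these are exchanged. The difference of traces is therefore a
sum of `1 - ⟨u_w, u_w'⟩` times a scalar minus a vector Hessian term. The diagonal drops out because
the `u_w` are unit vectors, and off the diagonal the Hessian factors into first derivatives, where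
`sum_fderiv_cutoff_mul_le` applies. -/
lemma trace_vectorProcess_le [Fintype W] [DecidableEq W]
    (lam : ℝ) (u : W → Fin n → ℝ) (hu : ∀ w, ∑ k, u w k ^ 2 = 1)
    (z : W → EuclideanSpace ℝ (Fin m) × ℝ) :
    ∑ i, fderiv ℝ (fun z => fderiv ℝ (fun z : W → _ => ∏ w, cutoff lam (z w)) z
          (vectorProcess (m := m) u (Pi.single i 1))) z (vectorProcess u (Pi.single i 1)) ≤
      ∑ i, fderiv ℝ (fun z => fderiv ℝ (fun z : W → _ => ∏ w, cutoff lam (z w)) z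
          (matrixProcess (m := m) u (Pi.single i 1))) z (matrixProcess u (Pi.single i 1)) := by
  have hc := cutoff_hasTemperateGrowth (m := m) lam
  simp only [Fintype.sum_sum_type, Fintype.sum_prod_type, matrixProcess_single_entry,
    matrixProcess_single_unit, matrixProcess_single_inr, vectorProcess_single_left,
    vectorProcess_single_right, vectorProcess_single_inl, map_zero, Finset.sum_const_zero,
    add_zero, zero_add, Finset.univ_unique, Finset.sum_singleton,
    PUnit.default_eq_unit]
  simp only [fderiv_fderiv_prod_smul hc z (fun _ => (1 : ℝ))]
  have h1 (k : Fin n) := fderiv_fderiv_prod_smul hc z (fun w => -u w k)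
    ((0 : EuclideanSpace ℝ (Fin m)), (1 : ℝ))
  have h2 (k : Fin n) (j : Fin m) := fderiv_fderiv_prod_smul hc z (fun w => u w k)
    (EuclideanSpace.single j (1 : ℝ), (0 : ℝ))
  simp only [h1, h2]
  rw [← sub_nonneg]
  have key : ∀ w w', 0 ≤ (1 - ∑ k, u w k * u w' k) *
      (prodHess (cutoff lam) z w w' (0, 1) (0, 1) -
        ∑ j, prodHess (cutoff lam) z w w' (EuclideanSpace.single j 1, 0) (EuclideanSpace.single j 1, 0)) := by
    intro w w'
    by_cases hw : w' = w
    · subst hw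
      simp only [← pow_two, hu, sub_self, zero_mul, le_refl]
    · refine mul_nonneg (sub_nonneg.2 (sum_mul_le_one (hu w) (hu w'))) (sub_nonneg.2 ?_)
      simp only [prodHess, if_neg hw]
      rw [← Finset.mul_sum]
      exact mul_le_mul_of_nonneg_left (sum_fderiv_cutoff_mul_le lam (z w') (z w))
        (Finset.prod_nonneg fun v _ => cutoff_nonneg _ _)
  have hk := Finset.sum_nonneg (s := Finset.univ) fun w _ =>
    Finset.sum_nonneg (s := Finset.univ) fun w' _ => key w w'
  refine hk.trans_eq ?_
  have e1 : ∑ j : Fin m, ∑ k, ∑ w, ∑ w', u w k * u w' k * prodHess (cutoff lam) z w w' (EuclideanSpace.single j 1, 0) (EuclideanSpace.single j 1, 0)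
      = ∑ w, ∑ w', (∑ k, u w k * u w' k) * ∑ j, prodHess (cutoff lam) z w w' (EuclideanSpace.single j 1, 0) (EuclideanSpace.single j 1, 0) := by
    simp only [Finset.sum_mul_sum]
    rw [Finset.sum_comm]
    simp only [Finset.sum_comm (s := (Finset.univ : Finset (Fin m)))]
    rw [Finset.sum_comm]
    refine Finset.sum_congr rfl fun w _ => ?_
    rw [Finset.sum_comm]
  have e2 : ∑ k, ∑ w, ∑ w', -u w k * -u w' k * prodHess (cutoff lam) z w w' (0, 1) (0, 1)
      = ∑ w, ∑ w', (∑ k, u w k * u w' k) * prodHess (cutoff lam) z w w' (0, 1) (0, 1) := by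
    simp only [Finset.sum_mul, neg_mul_neg]
    rw [Finset.sum_comm]
    refine Finset.sum_congr rfl fun w _ => ?_
    rw [Finset.sum_comm]
  have e3 : ∑ j : Fin m, ∑ w, ∑ w', 1 * 1 * prodHess (cutoff lam) z w w' (EuclideanSpace.single j 1, 0) (EuclideanSpace.single j 1, 0)
      = ∑ w, ∑ w', ∑ j, prodHess (cutoff lam) z w w' (EuclideanSpace.single j 1, 0) (EuclideanSpace.single j 1, 0) := by
    simp only [one_mul]
    rw [Finset.sum_comm]
    refine Finset.sum_congr rfl fun w _ => ?_
    rw [Finset.sum_comm]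
  rw [e1, e2, e3]
  simp only [← Finset.sum_add_distrib, ← Finset.sum_sub_distrib]
  refine Finset.sum_congr rfl fun w _ => Finset.sum_congr rfl fun w' _ => ?_
  ring

lemma integral_prod_cutoff_le [Fintype W] [DecidableEq W]
    (lam : ℝ) (u : W → Fin n → ℝ) (hu : ∀ w, ∑ k, u w k ^ 2 = 1) :
    ∫ x, ∏ w, cutoff lam (vectorProcess (m := m) u x w) ∂gaussianPi (GordonIndex m n) ≤
      ∫ x, ∏ w, cutoff lam (matrixProcess (m := m) u x w) ∂gaussianPi (GordonIndex m n) := by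
  refine integral_comp_le_of_trace_le (F := fun z : W → _ => ∏ w, cutoff lam (z w))
    (hasTemperateGrowth_prod (cutoff_hasTemperateGrowth lam)) _ _ (fun i => ?_)
    (trace_vectorProcess_le lam u hu)
  rcases i with i | i
  · exact Or.inr (vectorProcess_single_inl u i)
  · exact Or.inl (matrixProcess_single_inr u i)

/-- **Gordon's comparison inequality** for the events `min_w (‖A u_w‖ + g₀) ≤ lam`. -/
theorem gordon_measure_le [Fintype W]
    (lam : ℝ) (u : W → Fin n → ℝ) (hu : ∀ w, ∑ k, u w k ^ 2 = 1) :
    (gaussianPi (GordonIndex m n)) {x | ∃ w, softVal (matrixProcess u x w) ≤ lam} ≤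
      (gaussianPi (GordonIndex m n)) {x | ∃ w, softVal (vectorProcess u x w) ≤ lam + 1} := by
  classical
  set μ := gaussianPi (GordonIndex m n)
  have hcont (Z : (GordonIndex m n → ℝ) →L[ℝ] (W → EuclideanSpace ℝ (Fin m) × ℝ)) (w : W) :
      Continuous fun x => softVal (Z x w) := by
    have hs : Continuous (softVal : EuclideanSpace ℝ (Fin m) × ℝ → ℝ) :=
      softVal_hasTemperateGrowth.1.continuous
    exact hs.comp ((continuous_apply w).comp Z.continuous)
  have hmeas (Z : (GordonIndex m n → ℝ) →L[ℝ] (W → EuclideanSpace ℝ (Fin m) × ℝ)) (t : ℝ) :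
      MeasurableSet {x | ∃ w, softVal (Z x w) ≤ t} := by
    rw [Set.ofPred_exists]
    exact MeasurableSet.iUnion fun w => measurableSet_le (hcont Z w).measurable measurable_const
  have hint (Z : (GordonIndex m n → ℝ) →L[ℝ] (W → EuclideanSpace ℝ (Fin m) × ℝ)) :
      Integrable (fun x => ∏ w, cutoff lam (Z x w)) μ := by
    have h : ((fun z : W → EuclideanSpace ℝ (Fin m) × ℝ => ∏ w, cutoff lam (z w)) ∘
        Z).HasTemperateGrowth :=
      (hasTemperateGrowth_prod (cutoff_hasTemperateGrowth lam)).comp Z.hasTemperateGrowth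
    exact h.integrable_gaussianPi
  set S := {x | ∃ w, softVal (matrixProcess (m := m) u x w) ≤ lam}
  set T := {x | ∃ w, softVal (vectorProcess (m := m) u x w) ≤ lam + 1}
  -- The product of cutoffs lies between the indicators of "all values exceed `lam + 1`" and "all
  -- values exceed `lam`"; hence the loss of one in the level.
  have hS : ∫ x, ∏ w, cutoff lam (matrixProcess (m := m) u x w) ∂μ ≤ 1 - μ.real S := by
    rw [← probReal_compl_eq_one_sub (hmeas _ _), ← integral_indicator_one (hmeas _ _).compl]
    refine integral_mono (hint _) ((integrable_const 1).indicator (hmeas _ _).compl) fun x => ?_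
    by_cases hx : x ∈ S
    · rw [Set.indicator_of_notMem (Set.notMem_compl_iff.2 hx)]
      obtain ⟨w, hw⟩ := hx
      refine (Finset.prod_eq_zero (Finset.mem_univ w) ?_).le
      exact Real.smoothTransition.zero_of_nonpos (by linarith)
    · rw [Set.indicator_of_mem (Set.mem_compl hx)]
      exact Finset.prod_le_one (fun w _ => cutoff_nonneg _ _) fun w _ => cutoff_le_one _ _
  have hT : 1 - μ.real T ≤ ∫ x, ∏ w, cutoff lam (vectorProcess (m := m) u x w) ∂μ := by
    rw [← probReal_compl_eq_one_sub (hmeas _ _), ← integral_indicator_one (hmeas _ _).compl]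
    refine integral_mono ((integrable_const 1).indicator (hmeas _ _).compl) (hint _) fun x => ?_
    by_cases hx : x ∈ T
    · rw [Set.indicator_of_notMem (Set.notMem_compl_iff.2 hx)]
      exact Finset.prod_nonneg fun w _ => cutoff_nonneg _ _
    · rw [Set.indicator_of_mem (Set.mem_compl hx)]
      refine (Finset.prod_eq_one fun w _ => ?_).ge
      have : ¬ softVal (vectorProcess (m := m) u x w) ≤ lam + 1 := fun h => hx ⟨w, h⟩
      exact Real.smoothTransition.one_of_one_le (by linarith)
  have := integral_prod_cutoff_le (m := m) lam u hu
  have h : μ.real S ≤ μ.real T := by linarith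
  exact (ENNReal.toReal_le_toReal (measure_ne_top _ _) (measure_ne_top _ _)).1 h

end Gordon

/-! ### Splitting the Gaussian coordinates into independent blocks -/

section Transport

variable {m n : ℕ}

lemma measurePreserving_gaussianPi_sum (ι κ : Type*) [Fintype ι] [Fintype κ] :
    MeasurePreserving (MeasurableEquiv.sumPiEquivProdPi fun _ : ι ⊕ κ => ℝ)
      (gaussianPi (ι ⊕ κ)) ((gaussianPi ι).prod (gaussianPi κ)) :=
  measurePreserving_sumPiEquivProdPi fun _ => gaussianReal 0 1

lemma measurePreserving_gaussianPi_curry :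
    MeasurePreserving (MeasurableEquiv.curry (Fin m) (Fin n) ℝ)
      (gaussianPi (Fin m × Fin n)) (gaussianMatrix m n) := by
  refine ⟨MeasurableEquiv.measurable _, ?_⟩
  have h := Measure.infinitePi_map_curry (fun (_ : Fin m) (_ : Fin n) => gaussianReal 0 1)
  simp only [Measure.infinitePi_eq_pi] at h
  exact h

lemma measurePreserving_gaussianPi_unit :
    MeasurePreserving (fun x : Unit → ℝ => x ()) (gaussianPi Unit) (gaussianReal 0 1) :=
  measurePreserving_eval (fun _ : Unit => gaussianReal 0 1) ()

instance : IsProbabilityMeasure (gaussianMatrix m n) := by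
  unfold gaussianMatrix; infer_instance

lemma measurePreserving_matrixPart :
    MeasurePreserving (fun x : GordonIndex m n → ℝ =>
        ((fun j k => x (.inl (.inl (j, k))), x (.inl (.inr ()))) : (Fin m → Fin n → ℝ) × ℝ))
      (gaussianPi (GordonIndex m n)) ((gaussianMatrix m n).prod (gaussianReal 0 1)) :=
  ((measurePreserving_gaussianPi_curry.prod measurePreserving_gaussianPi_unit).comp
    (measurePreserving_gaussianPi_sum (Fin m × Fin n) Unit)).comp
    (measurePreserving_fst.comp (measurePreserving_gaussianPi_sum _ (Fin m ⊕ Fin n)))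

lemma measurePreserving_vectorPart :
    MeasurePreserving (fun x : GordonIndex m n → ℝ =>
        ((fun j => x (.inr (.inl j)), fun k => x (.inr (.inr k))) : (Fin m → ℝ) × (Fin n → ℝ)))
      (gaussianPi (GordonIndex m n)) ((gaussianPi (Fin m)).prod (gaussianPi (Fin n))) :=
  (measurePreserving_gaussianPi_sum (Fin m) (Fin n)).comp
    (measurePreserving_snd.comp (measurePreserving_gaussianPi_sum ((Fin m × Fin n) ⊕ Unit) _))

/-- The scalar `g₀` is independent of `A`, so the probability of the joint event factors. If `‖A
u_w‖ ≤ 1` then the smoothed norm is at most `√2 ≤ 2`, which accounts for `lam - 2`. -/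
theorem gordon_matrix_mul_le {W : Type*} [Fintype W] (lam : ℝ) (u : W → Fin n → ℝ)
    (hu : ∀ w, ∑ k, u w k ^ 2 = 1) :
    gaussianMatrix m n {A | ∃ w, ∑ j, (∑ k, u w k * A j k) ^ 2 ≤ 1} *
        gaussianReal 0 1 (Set.Iic (lam - 2)) ≤
      ((gaussianPi (Fin m)).prod (gaussianPi (Fin n)))
        {y | ∃ w, √(∑ j, y.1 j ^ 2) - ∑ k, u w k * y.2 k ≤ lam + 1} := by
  have hS : MeasurableSet {A : Fin m → Fin n → ℝ | ∃ w, ∑ j, (∑ k, u w k * A j k) ^ 2 ≤ 1} := by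
    rw [Set.ofPred_exists]
    exact MeasurableSet.iUnion fun w => measurableSet_le (by fun_prop) measurable_const
  have hT : MeasurableSet {y : (Fin m → ℝ) × (Fin n → ℝ) |
      ∃ w, √(∑ j, y.1 j ^ 2) - ∑ k, u w k * y.2 k ≤ lam + 1} := by
    rw [Set.ofPred_exists]
    exact MeasurableSet.iUnion fun w => measurableSet_le (by fun_prop) measurable_const
  rw [← Measure.prod_prod, ← measurePreserving_matrixPart.measure_preimage
      (hS.prod measurableSet_Iic).nullMeasurableSet,
    ← measurePreserving_vectorPart.measure_preimage hT.nullMeasurableSet]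
  refine ((measure_mono ?_).trans (gordon_measure_le lam u hu)).trans (measure_mono ?_)
  · rintro x ⟨⟨w, hw⟩, hx⟩
    refine ⟨w, ?_⟩
    rw [matrixProcess_apply, softVal]
    simp only [Set.mem_Iic] at hx
    simp only [EuclideanSpace.norm_sq_eq, Real.norm_eq_abs, sq_abs]
    have : √(1 + ∑ j, (∑ k, u w k * x (.inl (.inl (j, k)))) ^ 2) ≤ 2 :=
      Real.sqrt_le_iff.2 ⟨by norm_num, by linarith⟩
    linarith
  · rintro x ⟨w, hw⟩
    refine ⟨w, ?_⟩
    rw [vectorProcess_apply, softVal] at hw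
    simp only [EuclideanSpace.norm_sq_eq, Real.norm_eq_abs, sq_abs] at hw
    have : √(∑ j, x (.inr (.inl j)) ^ 2) ≤ √(1 + ∑ j, x (.inr (.inl j)) ^ 2) :=
      Real.sqrt_le_sqrt (by linarith)
    linarith

end Transport

/-! ### The spherical part -/

/-- `ISph` is the maximum over `s > 0` of `-s - α / (2c) log (1 + c / (2s))`. -/
lemma le_ISph {α c s : ℝ} (hα : 0 < α) (hc : 0 < c) (hs : 0 < s) :
    -s - α / (2 * c) * Real.log (1 + c / (2 * s)) ≤ ISph c α := by
  set t := -gammaSph c α with ht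
  have hq : (√(4 * c ^ 2 + 16 * α)) ^ 2 = 4 * c ^ 2 + 16 * α := Real.sq_sqrt (by positivity)
  have ht0 : 0 < t := by
    have : 2 * c < √(4 * c ^ 2 + 16 * α) := Real.lt_sqrt_of_sq_lt (by nlinarith)
    rw [ht, gammaSph]
    linarith
  -- This is the critical point equation of `s ↦ -s - α / (2c) log (1 + c / (2s))`.
  have hroot : α = 2 * t * (2 * t + c) := by
    have h8 : √(4 * c ^ 2 + 16 * α) = 8 * t + 2 * c := by
      rw [ht, gammaSph]
      ring
    rw [h8] at hq
    nlinarith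
  have hg : gammaSph c α = -t := by rw [ht, neg_neg]
  have hIS : ISph c α = -t - α / (2 * c) * Real.log (1 + c / (2 * t)) := by
    rw [ISph, hg]
    congr 3
    field_simp
    ring
  rw [hIS]
  have hlog : Real.log (1 + c / (2 * t)) - Real.log (1 + c / (2 * s)) ≤
      c * (s - t) / ((2 * s + c) * t) := by
    rw [← Real.log_div (by positivity) (by positivity)]
    refine (Real.log_le_sub_one_of_pos (by positivity)).trans_eq ?_
    field_simp
    ring
  have hk : 0 ≤ α / (2 * c) := by positivity
  have h1 := mul_le_mul_of_nonneg_left hlog hk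
  -- With the critical point equation, the bound `log x ≤ x - 1` leaves exactly `s - t` minus a
  -- square term, which proves maximality without calculus.
  have h2 : α / (2 * c) * (c * (s - t) / ((2 * s + c) * t)) =
      (s - t) - 2 * (s - t) ^ 2 / (2 * s + c) := by
    rw [hroot]
    field_simp
    ring
  have h3 : 0 ≤ 2 * (s - t) ^ 2 / (2 * s + c) := by positivity
  rw [h2, mul_sub] at h1
  linarith

lemma integral_gaussianReal (f : ℝ → ℝ) :
    ∫ x, f x ∂gaussianReal 0 1 = (√(2 * Real.pi))⁻¹ * ∫ x, f x * Real.exp (-x ^ 2 / 2) := by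
  rw [integral_gaussianReal_eq_integral_smul one_ne_zero, ← integral_const_mul]
  congr 1
  ext x
  simp [gaussianPDFReal]
  ring

lemma integral_exp_neg_mul_sq_gaussianReal {a : ℝ} (ha : 0 ≤ a) :
    ∫ x, Real.exp (-a * x ^ 2) ∂gaussianReal 0 1 = Real.exp (-(1 / 2) * Real.log (1 + 2 * a)) := by
  rw [integral_gaussianReal]
  simp only [← Real.exp_add]
  have h : (fun x : ℝ => Real.exp (-a * x ^ 2 + -x ^ 2 / 2)) =
      fun x => Real.exp (-(a + 1 / 2) * x ^ 2) := by
    ext x; ring_nf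
  rw [h, integral_gaussian, mul_comm (-(1 / 2)), ← Real.rpow_def_of_pos (by positivity),
    Real.rpow_neg (by positivity), ← Real.sqrt_eq_rpow, ← Real.sqrt_inv, ← Real.sqrt_inv,
    ← Real.sqrt_mul (by positivity)]
  congr 1
  have := Real.pi_pos
  field_simp
  ring

lemma integrable_exp_neg_mul_sq_gaussianReal {a : ℝ} (ha : 0 ≤ a) :
    Integrable (fun x => Real.exp (-a * x ^ 2)) (gaussianReal 0 1) := by
  refine (integrable_const (1 : ℝ)).mono' (by fun_prop) (Filter.Eventually.of_forall fun x => ?_)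
  rw [Real.norm_of_nonneg (Real.exp_pos _).le, Real.exp_le_one_iff]
  nlinarith [mul_nonneg ha (sq_nonneg x)]

/-! ### Laplace transform of the norm of a Gaussian vector -/

section Chi

variable {m : ℕ}

lemma exp_neg_mul_sum_sq_eq_prod (a : ℝ) (x : Fin m → ℝ) :
    Real.exp (-a * ∑ i, x i ^ 2) = ∏ i, Real.exp (-a * x i ^ 2) := by
  rw [← Real.exp_sum, Finset.mul_sum]

lemma integrable_exp_neg_mul_sum_sq {a : ℝ} (ha : 0 ≤ a) :
    Integrable (fun x : Fin m → ℝ => Real.exp (-a * ∑ i, x i ^ 2)) (gaussianPi (Fin m)) := by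
  simp only [exp_neg_mul_sum_sq_eq_prod]
  exact Integrable.fintype_prod fun _ => integrable_exp_neg_mul_sq_gaussianReal ha

lemma integral_exp_neg_mul_sum_sq {a : ℝ} (ha : 0 ≤ a) :
    ∫ x : Fin m → ℝ, Real.exp (-a * ∑ i, x i ^ 2) ∂gaussianPi (Fin m) =
      Real.exp (-(m / 2) * Real.log (1 + 2 * a)) := by
  simp only [exp_neg_mul_sum_sq_eq_prod]
  rw [gaussianPi, integral_fintype_prod_eq_prod (fun _ x => Real.exp (-a * x ^ 2))]
  simp only [integral_exp_neg_mul_sq_gaussianReal ha, Finset.prod_const, Finset.card_univ,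
    Fintype.card_fin, ← Real.exp_nat_mul]
  congr 1
  ring

/-- The function `-√n r` is dominated by finitely many of its tangent parabolas, up to `n η`. -/
lemma exp_neg_mul_sqrt_le {c η : ℝ} (hc : 0 < c) (hη : 0 < η) (J n : ℕ) {r : ℝ} (hr : 0 ≤ r) :
    Real.exp (-(c * √n * r)) ≤ Real.exp (-(2 * c * n * η * J)) +
      ∑ j ∈ Finset.range J, Real.exp (c * n * η - c * n * ((j + 1) * η)) *
        Real.exp (-(c / (4 * ((j + 1) * η))) * r ^ 2) := by
  have hsq : √(n : ℝ) * √(n : ℝ) = n := Real.mul_self_sqrt (Nat.cast_nonneg n)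
  have hs0 : 0 ≤ √(n : ℝ) := Real.sqrt_nonneg _
  rcases le_or_gt (2 * η * J * √n) r with h | h
  · refine le_add_of_le_of_nonneg (Real.exp_le_exp.2 (neg_le_neg ?_))
      (Finset.sum_nonneg fun j _ => by positivity)
    calc 2 * c * n * η * J = c * √n * (2 * η * J * √n) := by
          linear_combination -(2 * c * η * J) * hsq
      _ ≤ c * √n * r := by gcongr
  · have hsp : 0 < √(n : ℝ) := by
      refine lt_of_le_of_ne hs0 fun h0 => ?_
      rw [← h0, mul_zero] at h
      linarith
    -- The parabola with parameter `s` touches at `r = 2 s √n`. The grid point `s = (j + 1) η` puts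
    -- the contact point above `r`, at distance at most `2 η √n`; the shift `j + 1` keeps `s` at
    -- least `η`, as the error bound requires.
    set j := ⌊r / (2 * η * √n)⌋₊
    have hj1 : j * (2 * η * √n) ≤ r :=
      (le_div_iff₀ (by positivity)).1 (Nat.floor_le (by positivity))
    have hj2 : r < (j + 1) * (2 * η * √n) :=
      (div_lt_iff₀ (by positivity)).1 (Nat.lt_floor_add_one _)
    have hjJ : j < J := by
      rw [Nat.floor_lt (by positivity), div_lt_iff₀ (by positivity)]
      linarith
    refine le_add_of_nonneg_of_le (Real.exp_pos _).le ?_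
    refine le_trans ?_ (Finset.single_le_sum (f := fun j : ℕ =>
      Real.exp (c * n * η - c * n * ((j + 1) * η)) *
        Real.exp (-(c / (4 * ((j + 1) * η))) * r ^ 2)) (fun j _ => by positivity)
        (Finset.mem_range.2 hjJ))
    rw [← Real.exp_add, Real.exp_le_exp]
    set s : ℝ := (j + 1) * η with hs
    have hsη : η ≤ s := by
      rw [hs]
      nlinarith [(Nat.cast_nonneg j : (0 : ℝ) ≤ j)]
    have hs1 : 0 < s := hη.trans_le hsη
    have hd : (r - 2 * s * √n) ^ 2 ≤ 4 * s * (n * η) := by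
      have h1 : 2 * s * √n - r ≤ 2 * η * √n := by rw [hs]; linarith
      have h2 : 0 ≤ 2 * s * √n - r := by rw [hs]; linarith
      have h3 : (2 * s * √n - r) ^ 2 ≤ (2 * η * √n) ^ 2 := by gcongr
      have h4 : (2 * η * √n) ^ 2 = 4 * η * (n * η) := by linear_combination 4 * η ^ 2 * hsq
      have h5 : 4 * η * (n * η) ≤ 4 * s * (n * η) := by gcongr
      nlinarith
    have hkey : r ^ 2 / (4 * s) + n * s - √n * r ≤ n * η := by
      have : r ^ 2 / (4 * s) + n * s - √n * r = (r - 2 * s * √n) ^ 2 / (4 * s) := by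
        have h4 : r ^ 2 / (4 * s) * (4 * s) = r ^ 2 := div_mul_cancel₀ _ (by positivity)
        rw [eq_div_iff (by positivity)]
        linear_combination h4 - 4 * s ^ 2 * hsq
      rw [this, div_le_iff₀ (by positivity)]
      linarith
    have h6 := mul_le_mul_of_nonneg_left hkey hc.le
    have h7 : c / (4 * s) * r ^ 2 = c * (r ^ 2 / (4 * s)) := by ring
    rw [neg_mul, h7]
    nlinarith

lemma integrable_exp_neg_mul_norm {a : ℝ} (ha : 0 ≤ a) :
    Integrable (fun x : Fin m → ℝ => Real.exp (-(a * √(∑ i, x i ^ 2)))) (gaussianPi (Fin m)) := by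
  refine (integrable_const (1 : ℝ)).mono' (Continuous.aestronglyMeasurable (by fun_prop)) (Filter.Eventually.of_forall fun x => ?_)
  rw [Real.norm_of_nonneg (Real.exp_pos _).le, Real.exp_le_one_iff, neg_nonpos]
  positivity

/-- The Laplace transform of the norm of a standard Gaussian vector. -/
lemma exists_integral_exp_neg_norm_le {α c η : ℝ} (hα : 0 < α) (hc : 0 < c) (hη : 0 < η) :
    ∃ K : ℝ, 0 < K ∧ ∀ n m : ℕ, α * n ≤ m →
      ∫ x : Fin m → ℝ, Real.exp (-(c * √n * √(∑ i, x i ^ 2))) ∂gaussianPi (Fin m) ≤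
        K * Real.exp (c * n * (ISph c α + η)) := by
  -- Enough grid points for the constant term `e^{-2 c n η J}` to be at most `e^{c n ISph}`.
  set J := ⌈-ISph c α / (2 * η)⌉₊
  have hJ : -ISph c α ≤ J * (2 * η) := (div_le_iff₀ (by positivity)).1 (Nat.le_ceil _)
  refine ⟨J + 1, by positivity, fun n m hm => ?_⟩
  have ha (j : ℕ) : 0 ≤ c / (4 * ((j + 1) * η)) := by positivity
  have hint (j : ℕ) := (integrable_exp_neg_mul_sum_sq (m := m) (ha j)).const_mul
    (Real.exp (c * n * η - c * n * ((j + 1) * η)))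
  calc ∫ x : Fin m → ℝ, Real.exp (-(c * √n * √(∑ i, x i ^ 2))) ∂gaussianPi (Fin m)
      ≤ ∫ x : Fin m → ℝ, (Real.exp (-(2 * c * n * η * J)) +
        ∑ j ∈ Finset.range J, Real.exp (c * n * η - c * n * ((j + 1) * η)) *
        Real.exp (-(c / (4 * ((j + 1) * η))) * ∑ i, x i ^ 2)) ∂gaussianPi (Fin m) := by
        refine integral_mono (integrable_exp_neg_mul_norm (by positivity))
          ((integrable_const _).add (integrable_finsetSum _ fun j _ => hint j)) fun x => ?_
        have h := exp_neg_mul_sqrt_le hc hη J n (Real.sqrt_nonneg (∑ i, x i ^ 2))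
        rwa [Real.sq_sqrt (Finset.sum_nonneg fun i _ => sq_nonneg _)] at h
    _ = Real.exp (-(2 * c * n * η * J)) +
        ∑ j ∈ Finset.range J, Real.exp (c * n * η - c * n * ((j + 1) * η)) *
        Real.exp (-(m / 2) * Real.log (1 + 2 * (c / (4 * ((j + 1) * η))))) := by
        rw [integral_add (integrable_const _) (integrable_finsetSum _ fun j _ => hint j),
          integral_finsetSum _ fun j _ => hint j]
        simp only [integral_const_mul, integral_exp_neg_mul_sum_sq (ha _)]
        simp
    _ ≤ Real.exp (c * n * (ISph c α + η)) +
        ∑ j ∈ Finset.range J, Real.exp (c * n * (ISph c α + η)) := by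
        refine add_le_add (Real.exp_le_exp.2 ?_) (Finset.sum_le_sum fun j _ => ?_)
        · have hcn : 0 ≤ c * n := by positivity
          nlinarith [mul_le_mul_of_nonneg_left hJ hcn]
        · rw [← Real.exp_add, Real.exp_le_exp]
          set s : ℝ := (j + 1) * η
          have hs : 0 < s := by positivity
          have h1 := le_ISph hα hc hs
          have h2 : 1 + 2 * (c / (4 * s)) = 1 + c / (2 * s) := by
            field_simp
            ring
          have h3 : 0 ≤ Real.log (1 + c / (2 * s)) :=
            Real.log_nonneg (by linarith [show 0 ≤ c / (2 * s) by positivity])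
          rw [h2]
          have h4 := mul_le_mul_of_nonneg_right hm h3
          have h5 := mul_le_mul_of_nonneg_left h1 (show 0 ≤ c * n by positivity)
          have h6 : c * n * (-s - α / (2 * c) * Real.log (1 + c / (2 * s))) =
            -(c * n * s) - α * n * Real.log (1 + c / (2 * s)) / 2 := by
            field_simp
          rw [h6] at h5
          linarith
    _ = (J + 1) * Real.exp (c * n * (ISph c α + η)) := by
        rw [Finset.sum_const, Finset.card_range, nsmul_eq_mul]
        ring

end Chi

/-- On the unit interval `[-t - 1, -t]` the density is at least its value at the left end. -/
lemma le_gaussianReal_Iic_neg {t : ℝ} (ht : 0 ≤ t) :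
    ENNReal.ofReal ((√(2 * Real.pi))⁻¹ * Real.exp (-(t + 1) ^ 2 / 2)) ≤
      gaussianReal 0 1 (Set.Iic (-t)) := by
  set K := ENNReal.ofReal ((√(2 * Real.pi))⁻¹ * Real.exp (-(t + 1) ^ 2 / 2))
  calc K = ∫⁻ _ in Set.Icc (-t - 1) (-t), K := by simp
    _ ≤ ∫⁻ x in Set.Icc (-t - 1) (-t), gaussianPDF 0 1 x := by
        refine setLIntegral_mono (measurable_gaussianPDF 0 1) fun x hx => ?_
        refine ENNReal.ofReal_le_ofReal ?_
        simp only [gaussianPDFReal, NNReal.coe_one, mul_one, sub_zero]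
        have h : x ^ 2 ≤ (t + 1) ^ 2 := by nlinarith [hx.1, hx.2]
        gcongr
    _ = gaussianReal 0 1 (Set.Icc (-t - 1) (-t)) := (gaussianReal_apply 0 one_ne_zero _).symm
    _ ≤ _ := measure_mono fun x hx => hx.2

/-! ### Lagrangian duality -/

/-- `tPlus` is the larger of two maxima of `(h - ν₁) u - γ u²`: over all `u` with penalty `-ν₂`, and
over `u ≥ 0` with reward `ν₂`. For `h ≤ ν₁` they cross where `(h - ν₁)² / (4γ) = 2 ν₂`, that is at
`h = ν₁ - √(8γν₂)`. -/
lemma tPlus_ge_of_neg {γ ν₁ ν₂ h u : ℝ} (hγ : 0 < γ) (hν₂ : 0 ≤ ν₂) :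
    (h - ν₁) * u - γ * u ^ 2 - ν₂ ≤ tPlus γ ν₁ ν₂ h := by
  have hmax : (h - ν₁) * u - γ * u ^ 2 ≤ (h - ν₁) ^ 2 / (4 * γ) := by
    rw [le_div_iff₀ (by positivity)]
    nlinarith [sq_nonneg (h - ν₁ - 2 * γ * u)]
  have heq : (h ^ 2 + ν₁ ^ 2) / (4 * γ) - h * ν₁ / (2 * γ) = (h - ν₁) ^ 2 / (4 * γ) := by
    field_simp
    ring
  unfold tPlus
  rw [heq]
  split_ifs with h1 h2
  · linarith
  · have hs : (ν₁ - h) ^ 2 ≤ 8 * γ * ν₂ := by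
      have h3 : ν₁ - h ≤ √(8 * γ * ν₂) := by linarith
      calc (ν₁ - h) ^ 2 ≤ √(8 * γ * ν₂) ^ 2 := by gcongr
        _ = _ := Real.sq_sqrt (by positivity)
    have : (h - ν₁) ^ 2 / (4 * γ) ≤ 2 * ν₂ := by
      rw [div_le_iff₀ (by positivity)]
      linarith
    linarith
  · linarith

lemma tPlus_ge_of_nonneg {γ ν₁ ν₂ h u : ℝ} (hγ : 0 < γ) (hν₂ : 0 ≤ ν₂) (hu : 0 ≤ u) :
    (h - ν₁) * u - γ * u ^ 2 + ν₂ ≤ tPlus γ ν₁ ν₂ h := by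
  have hmax : (h - ν₁) * u - γ * u ^ 2 ≤ (h - ν₁) ^ 2 / (4 * γ) := by
    rw [le_div_iff₀ (by positivity)]
    nlinarith [sq_nonneg (h - ν₁ - 2 * γ * u)]
  have heq : (h ^ 2 + ν₁ ^ 2) / (4 * γ) - h * ν₁ / (2 * γ) = (h - ν₁) ^ 2 / (4 * γ) := by
    field_simp
    ring
  have hneg (hh : h ≤ ν₁) : (h - ν₁) * u - γ * u ^ 2 ≤ 0 := by
    nlinarith [mul_nonneg (sub_nonneg.2 hh) hu, mul_nonneg hγ.le (sq_nonneg u)]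
  unfold tPlus
  rw [heq]
  split_ifs with h1 h2
  · have hs : 8 * γ * ν₂ ≤ (ν₁ - h) ^ 2 := by
      have h3 : √(8 * γ * ν₂) ≤ ν₁ - h := by linarith
      calc 8 * γ * ν₂ = √(8 * γ * ν₂) ^ 2 := (Real.sq_sqrt (by positivity)).symm
        _ ≤ _ := by gcongr
    have : 2 * ν₂ ≤ (h - ν₁) ^ 2 / (4 * γ) := by
      rw [le_div_iff₀ (by positivity)]
      linarith
    linarith [hneg (h1.trans (by linarith [Real.sqrt_nonneg (8 * γ * ν₂)]))]
  · linarith [hneg h2]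
  · linarith

/-- The unit vectors among the directions along which recovery of a non-negative `k`-sparse vector
can fail. -/
def failureDirections (n k : ℕ) : Set (Fin n → ℝ) :=
  {w | ∑ i, w i ^ 2 = 1 ∧ ∑ i, w i ≤ 0 ∧ (Finset.univ.filter fun i => w i < 0).card ≤ k}

/-- Weak duality for `u = √n w`: `ν₁` is the multiplier of the sum constraint, `γ` of the norm and
`ν₂` of the number of negative entries. The last constraint is encoded by `ν₂` times a sign for each
coordinate, whose total is at least `ν₂ (n - 2k)`. The Lagrangian decouples over coordinates. -/
lemma sqrt_mul_inner_le {n k : ℕ} {γ ν₁ ν₂ : ℝ} (hγ : 0 < γ) (hν₁ : 0 ≤ ν₁) (hν₂ : 0 ≤ ν₂)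
    {w : Fin n → ℝ} (hw : w ∈ failureDirections n k) (h : Fin n → ℝ) :
    √n * ∑ i, w i * h i ≤ ν₂ * (2 * k - n) + γ * n + ∑ i, tPlus γ ν₁ ν₂ (h i) := by
  obtain ⟨h1, h2, h3⟩ := hw
  have hsq : √(n : ℝ) ^ 2 = n := Real.sq_sqrt (Nat.cast_nonneg n)
  have hpt (i : Fin n) : (h i - ν₁) * (√n * w i) - γ * (√n * w i) ^ 2 +
      (ν₂ - 2 * ν₂ * if w i < 0 then 1 else 0) ≤ tPlus γ ν₁ ν₂ (h i) := by
    split_ifs with hi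
    · linarith [tPlus_ge_of_neg (h := h i) (u := √n * w i) (ν₁ := ν₁) hγ hν₂]
    · have : 0 ≤ √n * w i := mul_nonneg (Real.sqrt_nonneg _) (not_lt.1 hi)
      linarith [tPlus_ge_of_nonneg (h := h i) (ν₁ := ν₁) hγ hν₂ this]
  have hsum := Finset.sum_le_sum fun i (_ : i ∈ Finset.univ) => hpt i
  have hcard : (∑ i, if w i < 0 then (1 : ℝ) else 0) ≤ k := by
    rw [Finset.sum_boole]
    exact_mod_cast h3
  have e1 : ∑ i, ((h i - ν₁) * (√n * w i) - γ * (√n * w i) ^ 2 +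
      (ν₂ - 2 * ν₂ * if w i < 0 then 1 else 0)) =
      √n * ∑ i, w i * h i - ν₁ * √n * ∑ i, w i - γ * n * ∑ i, w i ^ 2 +
      (n * ν₂ - 2 * ν₂ * ∑ i, if w i < 0 then (1 : ℝ) else 0) := by
    have hconst : (n : ℝ) * ν₂ = ∑ _i : Fin n, ν₂ := by simp
    rw [hconst, Finset.mul_sum, Finset.mul_sum, Finset.mul_sum, Finset.mul_sum,
      ← Finset.sum_sub_distrib, ← Finset.sum_sub_distrib, ← Finset.sum_sub_distrib,
      ← Finset.sum_add_distrib]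
    refine Finset.sum_congr rfl fun i _ => ?_
    rw [mul_pow, hsq]
    ring
  rw [e1, h1] at hsum
  have h4 : ν₁ * √n * ∑ i, w i ≤ 0 := mul_nonpos_of_nonneg_of_nonpos (by positivity) h2
  nlinarith [mul_le_mul_of_nonneg_left hcard hν₂]

/-! ### The closed form of `E exp (c t⁺(h))` -/

lemma integrable_exp_neg_sq : Integrable fun x : ℝ => Real.exp (-x ^ 2) := by
  simpa using integrable_exp_neg_mul_sq (b := 1) one_pos

lemma integral_Ioi_exp_neg_sq (x : ℝ) :
    ∫ t in Set.Ioi x, Real.exp (-t ^ 2) = √Real.pi / 2 * erfc x := by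
  have h0 : ∫ t in Set.Ioi (0 : ℝ), Real.exp (-t ^ 2) = √Real.pi / 2 := by
    simpa using integral_gaussian_Ioi 1
  have h := intervalIntegral.integral_Ioi_sub_Ioi' (a := 0) (b := x)
    integrable_exp_neg_sq.integrableOn integrable_exp_neg_sq.integrableOn
  have hpi : √Real.pi ≠ 0 := (Real.sqrt_pos.2 Real.pi_pos).ne'
  rw [erfc, erf, ← h, h0]
  field_simp
  ring

lemma integral_Iic_exp_neg_sq (x : ℝ) :
    ∫ t in Set.Iic x, Real.exp (-t ^ 2) = √Real.pi / 2 * (2 - erfc x) := by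
  have h := intervalIntegral.integral_Iic_add_Ioi (b := x)
    integrable_exp_neg_sq.integrableOn integrable_exp_neg_sq.integrableOn
  have h1 : ∫ t : ℝ, Real.exp (-t ^ 2) = √Real.pi := by simpa using integral_gaussian 1
  rw [integral_Ioi_exp_neg_sq, h1] at h
  linarith

lemma integrable_exp_neg_affine_sq {a : ℝ} (ha : 0 < a) (d : ℝ) :
    Integrable fun x : ℝ => Real.exp (-(a * x - d) ^ 2) :=
  (integrable_exp_neg_sq.comp_sub_right d).comp_mul_left' ha.ne'

lemma setIntegral_exp_neg_affine_sq {a : ℝ} (ha : 0 < a) (d : ℝ) {s : Set ℝ}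
    (hs : MeasurableSet s) :
    ∫ x in (fun x => a * x - d) ⁻¹' s, Real.exp (-(a * x - d) ^ 2) =
      a⁻¹ * ∫ x in s, Real.exp (-x ^ 2) := by
  have hm : MeasurableSet ((fun x => a * x - d) ⁻¹' s) := (by fun_prop : Measurable _) hs
  rw [← integral_indicator hs, ← integral_indicator hm,
    ← integral_sub_right_eq_self (s.indicator fun x => Real.exp (-x ^ 2)) d]
  have h := Measure.integral_comp_mul_left
    (fun x => s.indicator (fun x => Real.exp (-x ^ 2)) (x - d)) a
  rw [abs_of_pos (inv_pos.2 ha), smul_eq_mul] at h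
  rw [← h]
  rfl

lemma integral_Iic_exp_neg_affine_sq {a : ℝ} (ha : 0 < a) (d y : ℝ) :
    ∫ x in Set.Iic y, Real.exp (-(a * x - d) ^ 2) =
      a⁻¹ * (√Real.pi / 2 * (2 - erfc (a * y - d))) := by
  rw [← integral_Iic_exp_neg_sq, ← setIntegral_exp_neg_affine_sq ha d measurableSet_Iic]
  congr 2
  ext x
  simp [ha]

lemma integral_Ioi_exp_neg_affine_sq {a : ℝ} (ha : 0 < a) (d y : ℝ) :
    ∫ x in Set.Ioi y, Real.exp (-(a * x - d) ^ 2) =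
      a⁻¹ * (√Real.pi / 2 * erfc (a * y - d)) := by
  rw [← integral_Ioi_exp_neg_sq, ← setIntegral_exp_neg_affine_sq ha d measurableSet_Ioi]
  congr 2
  ext x
  simp [ha]

lemma integral_Ioc_exp_neg_affine_sq {a : ℝ} (ha : 0 < a) (d : ℝ) {x y : ℝ} (hxy : x ≤ y) :
    ∫ x in Set.Ioc x y, Real.exp (-(a * x - d) ^ 2) =
      a⁻¹ * (√Real.pi / 2 * (erfc (a * x - d) - erfc (a * y - d))) := by
  have hi := integrable_exp_neg_affine_sq ha d
  have h := setIntegral_union (Set.Ioc_disjoint_Ioi le_rfl) measurableSet_Ioi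
    (hi.integrableOn (s := Set.Ioc x y)) (hi.integrableOn (s := Set.Ioi y))
  rw [Set.Ioc_union_Ioi_eq_Ioi hxy, integral_Ioi_exp_neg_affine_sq ha,
    integral_Ioi_exp_neg_affine_sq ha] at h
  linarith

section ClosedForm

variable {c γ ν₁ ν₂ : ℝ}

lemma half_sub_pPlus_pos (hc : 0 < c) (hγ : c / 2 < γ) : 0 < 1 / 2 - pPlus c γ := by
  have hγ0 : 0 < γ := by linarith
  rw [pPlus, sub_pos, div_lt_iff₀ hγ0]
  linarith

/-- This identifies `dPlus` as the shift that completes the square in `(1/2 - p) h² - q h`. -/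
lemma two_mul_sqrt_mul_dPlus (hc : 0 < c) (hγ : c / 2 < γ) :
    2 * √(1 / 2 - pPlus c γ) * dPlus c γ ν₁ = qPlus c γ ν₁ := by
  have hk := half_sub_pPlus_pos hc hγ
  have h4 : √(2 * (1 - 2 * pPlus c γ)) = 2 * √(1 / 2 - pPlus c γ) := by
    rw [show 2 * (1 - 2 * pPlus c γ) = 2 ^ 2 * (1 / 2 - pPlus c γ) by ring,
      Real.sqrt_mul (by positivity), Real.sqrt_sq (by norm_num)]
  rw [dPlus, h4, mul_div_cancel₀]
  exact (mul_pos two_pos (Real.sqrt_pos.2 hk)).ne'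

/-- Completing the square in the quadratic pieces of `c t⁺(h) - h² / 2`. -/
lemma quadratic_sub_half_sq (hc : 0 < c) (hγ : c / 2 < γ) (h ε : ℝ) :
    c * ((h ^ 2 + ν₁ ^ 2) / (4 * γ) - h * ν₁ / (2 * γ) + ε) + -h ^ 2 / 2 =
      (dPlus c γ ν₁ ^ 2 + c * (ν₁ ^ 2 / 4 / γ + ε)) +
        -(√(1 / 2 - pPlus c γ) * h - dPlus c γ ν₁) ^ 2 := by
  have hk := Real.sq_sqrt (half_sub_pPlus_pos hc hγ).le
  have hd := two_mul_sqrt_mul_dPlus (ν₁ := ν₁) hc hγ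
  have hγ0 : γ ≠ 0 := by linarith
  have e : c * ((h ^ 2 + ν₁ ^ 2) / (4 * γ) - h * ν₁ / (2 * γ) + ε) =
      pPlus c γ * h ^ 2 + qPlus c γ ν₁ * h + c * (ν₁ ^ 2 / 4 / γ + ε) := by
    rw [pPlus, qPlus]
    field_simp
    ring
  rw [e]
  linear_combination h ^ 2 * hk - h * hd

/-- The integrand `exp (c t⁺(h) - h² / 2)`. -/
noncomputable def tPlusWeight (c γ ν₁ ν₂ h : ℝ) : ℝ :=
  Real.exp (c * tPlus γ ν₁ ν₂ h) * Real.exp (-h ^ 2 / 2)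

lemma tPlusWeight_of_le (hc : 0 < c) (hγ : c / 2 < γ) {h : ℝ} (hh : h ≤ ν₁ - √(8 * γ * ν₂)) :
    tPlusWeight c γ ν₁ ν₂ h = Real.exp (dPlus c γ ν₁ ^ 2 + rPlus c γ ν₁ ν₂) *
      Real.exp (-(√(1 / 2 - pPlus c γ) * h - dPlus c γ ν₁) ^ 2) := by
  rw [tPlusWeight, tPlus, if_pos hh, ← Real.exp_add, ← Real.exp_add, sub_eq_add_neg _ ν₂,
    quadratic_sub_half_sq hc hγ, rPlus, sub_eq_add_neg _ ν₂]

lemma tPlusWeight_of_gt (hc : 0 < c) (hγ : c / 2 < γ) {h : ℝ} (hh : ν₁ < h) :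
    tPlusWeight c γ ν₁ ν₂ h = Real.exp (dPlus c γ ν₁ ^ 2 + r1Plus c γ ν₁ ν₂) *
      Real.exp (-(√(1 / 2 - pPlus c γ) * h - dPlus c γ ν₁) ^ 2) := by
  rw [tPlusWeight, tPlus, if_neg (by linarith [Real.sqrt_nonneg (8 * γ * ν₂)]),
    if_neg (not_le.2 hh), ← Real.exp_add, ← Real.exp_add, quadratic_sub_half_sq hc hγ, r1Plus]

lemma tPlusWeight_of_mem {h : ℝ} (h1 : ν₁ - √(8 * γ * ν₂) < h) (h2 : h ≤ ν₁) :
    tPlusWeight c γ ν₁ ν₂ h = Real.exp (c * ν₂) * Real.exp (-((√2)⁻¹ * h - 0) ^ 2) := by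
  rw [tPlusWeight, tPlus, if_neg (not_le.2 h1), if_pos h2, sub_zero, mul_pow, inv_pow,
    Real.sq_sqrt zero_le_two]
  congr 2
  ring

lemma integrableOn_tPlusWeight_Iic (hc : 0 < c) (hγ : c / 2 < γ) :
    IntegrableOn (tPlusWeight c γ ν₁ ν₂) (Set.Iic (ν₁ - √(8 * γ * ν₂))) :=
  ((integrable_exp_neg_affine_sq (Real.sqrt_pos.2 (half_sub_pPlus_pos hc hγ)) _).const_mul
    _).integrableOn.congr_fun (fun _ hx => (tPlusWeight_of_le hc hγ hx).symm) measurableSet_Iic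

lemma integrableOn_tPlusWeight_Ioi (hc : 0 < c) (hγ : c / 2 < γ) :
    IntegrableOn (tPlusWeight c γ ν₁ ν₂) (Set.Ioi ν₁) :=
  ((integrable_exp_neg_affine_sq (Real.sqrt_pos.2 (half_sub_pPlus_pos hc hγ)) _).const_mul
    _).integrableOn.congr_fun (fun _ hx => (tPlusWeight_of_gt hc hγ hx).symm) measurableSet_Ioi

lemma integrableOn_tPlusWeight_Ioc :
    IntegrableOn (tPlusWeight c γ ν₁ ν₂) (Set.Ioc (ν₁ - √(8 * γ * ν₂)) ν₁) :=
  ((integrable_exp_neg_affine_sq (by positivity : 0 < (√2)⁻¹) 0).const_mul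
    _).integrableOn.congr_fun (fun _ hx => (tPlusWeight_of_mem hx.1 hx.2).symm) measurableSet_Ioc

lemma integrable_tPlusWeight (hc : 0 < c) (hγ : c / 2 < γ) :
    Integrable (tPlusWeight c γ ν₁ ν₂) := by
  have hle : ν₁ - √(8 * γ * ν₂) ≤ ν₁ := by linarith [Real.sqrt_nonneg (8 * γ * ν₂)]
  rw [← integrableOn_univ, ← Set.Iic_union_Ioi (a := ν₁), ← Set.Iic_union_Ioc_eq_Iic hle]
  exact ((integrableOn_tPlusWeight_Iic hc hγ).union integrableOn_tPlusWeight_Ioc).union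
    (integrableOn_tPlusWeight_Ioi hc hγ)

lemma inv_sqrt_two_pi_mul (x : ℝ) :
    (√(2 * Real.pi))⁻¹ * (√Real.pi / 2 * x) = x / (2 * √2) := by
  have hpi : √Real.pi ≠ 0 := (Real.sqrt_pos.2 Real.pi_pos).ne'
  rw [Real.sqrt_mul zero_le_two]
  field_simp

lemma integral_tPlusWeight (hc : 0 < c) (hγ : c / 2 < γ) :
    (√(2 * Real.pi))⁻¹ * ∫ h, tPlusWeight c γ ν₁ ν₂ h = IPlus c γ ν₁ ν₂ := by
  have hle : ν₁ - √(8 * γ * ν₂) ≤ ν₁ := by linarith [Real.sqrt_nonneg (8 * γ * ν₂)]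
  have hk := Real.sqrt_pos.2 (half_sub_pPlus_pos hc hγ)
  rw [← setIntegral_univ, ← Set.Iic_union_Ioi (a := ν₁),
    setIntegral_union (Set.Iic_disjoint_Ioi le_rfl) measurableSet_Ioi
      (integrable_tPlusWeight hc hγ).integrableOn (integrable_tPlusWeight hc hγ).integrableOn,
    ← Set.Iic_union_Ioc_eq_Iic hle,
    setIntegral_union (Set.Iic_disjoint_Ioc le_rfl) measurableSet_Ioc
      (integrable_tPlusWeight hc hγ).integrableOn (integrable_tPlusWeight hc hγ).integrableOn,
    setIntegral_congr_fun measurableSet_Iic fun _ hx => tPlusWeight_of_le hc hγ hx,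
    setIntegral_congr_fun measurableSet_Ioi fun _ hx => tPlusWeight_of_gt hc hγ hx,
    setIntegral_congr_fun measurableSet_Ioc fun _ hx => tPlusWeight_of_mem hx.1 hx.2,
    integral_const_mul, integral_const_mul, integral_const_mul,
    integral_Iic_exp_neg_affine_sq hk, integral_Ioi_exp_neg_affine_sq hk,
    integral_Ioc_exp_neg_affine_sq (by positivity) _ hle, IPlus, mul_add, mul_add]
  congr 1
  · congr 1
    · rw [I1Plus, C1Plus, bPlus, mul_comm (ν₁ - √(8 * γ * ν₂))]
      have := inv_sqrt_two_pi_mul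
        (2 - erfc (√(1 / 2 - pPlus c γ) * (ν₁ - √(8 * γ * ν₂)) - dPlus c γ ν₁))
      rw [mul_left_comm, mul_left_comm _ (√(1 / 2 - pPlus c γ))⁻¹, this]
      field_simp
    · rw [I2Plus, bPlus]
      -- On the middle interval `tPlus` is constant, so the scale is that of the plain Gaussian,
      -- `1/√2`, and the factor contained in `bPlus` has to be cancelled.
      have e1 : (ν₁ - √(8 * γ * ν₂)) * √(1 / 2 - pPlus c γ) / √2 / √(1 / 2 - pPlus c γ) =
          (√2)⁻¹ * (ν₁ - √(8 * γ * ν₂)) - 0 := by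
        rw [sub_zero, div_right_comm, mul_div_cancel_right₀ _ hk.ne', div_eq_inv_mul]
      have e2 : ν₁ / √2 = (√2)⁻¹ * ν₁ - 0 := by
        field_simp
        ring
      rw [e1, e2]
      have := inv_sqrt_two_pi_mul (erfc ((√2)⁻¹ * (ν₁ - √(8 * γ * ν₂)) - 0) -
        erfc ((√2)⁻¹ * ν₁ - 0))
      rw [mul_left_comm, mul_left_comm _ ((√2)⁻¹)⁻¹, this]
      field_simp
  · rw [I3Plus, C3Plus, aPlus, mul_comm ν₁]
    have := inv_sqrt_two_pi_mul (erfc (√(1 / 2 - pPlus c γ) * ν₁ - dPlus c γ ν₁))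
    rw [mul_left_comm, mul_left_comm _ (√(1 / 2 - pPlus c γ))⁻¹, this]
    field_simp

theorem integral_exp_mul_tPlus (hc : 0 < c) (hγ : c / 2 < γ) :
    ∫ h, Real.exp (c * tPlus γ ν₁ ν₂ h) ∂gaussianReal 0 1 = IPlus c γ ν₁ ν₂ := by
  rw [integral_gaussianReal, ← integral_tPlusWeight hc hγ]
  rfl

theorem integrable_exp_mul_tPlus (hc : 0 < c) (hγ : c / 2 < γ) :
    Integrable (fun h => Real.exp (c * tPlus γ ν₁ ν₂ h)) (gaussianReal 0 1) := by
  rw [gaussianReal_of_var_ne_zero 0 one_ne_zero, integrable_withDensity_iff_integrable_smul'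
    (measurable_gaussianPDF 0 1) (Filter.Eventually.of_forall fun _ => gaussianPDF_lt_top)]
  refine ((integrable_tPlusWeight (ν₁ := ν₁) (ν₂ := ν₂) hc hγ).const_mul (√(2 * Real.pi))⁻¹).congr
    (Filter.Eventually.of_forall fun x => ?_)
  simp only [toReal_gaussianPDF, gaussianPDFReal, NNReal.coe_one, mul_one, sub_zero, smul_eq_mul,
    tPlusWeight]
  ring

lemma IPlus_pos (hc : 0 < c) (hγ : c / 2 < γ) : 0 < IPlus c γ ν₁ ν₂ := by
  rw [← integral_exp_mul_tPlus hc hγ]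
  exact integral_exp_pos (integrable_exp_mul_tPlus hc hγ)

end ClosedForm

/-! ### Failure of recovery -/

section Recovery

variable {m n : ℕ}

lemma exists_failureDirection {k : ℕ} {A : Fin m → Fin n → ℝ}
    (hA : ¬ RecoversAll k (Matrix.of A)) :
    ∃ w ∈ failureDirections n k, ∀ j, ∑ i, w i * A j i = 0 := by
  simp only [RecoversAll, not_forall] at hA
  obtain ⟨x, hx, hk, z, hz⟩ := hA
  have hxf : Feasible (Matrix.of A) ((Matrix.of A).mulVec x) x := ⟨rfl, hx⟩
  -- The equivalence can fail in two ways: `x` is not a minimizer, or another point is one. Both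
  -- give a competitor that is no worse than `x`.
  obtain ⟨y, hy, hyx, hle⟩ : ∃ y, Feasible (Matrix.of A) ((Matrix.of A).mulVec x) y ∧ y ≠ x ∧
      l1Norm y ≤ l1Norm x := by
    by_cases hzx : z = x
    · subst hzx
      have hns : ¬ IsSolution (Matrix.of A) ((Matrix.of A).mulVec z) z := fun h => hz (by simp [h])
      simp only [IsSolution, not_and, not_forall, not_le] at hns
      obtain ⟨y, hy, hlt⟩ := hns hxf
      exact ⟨y, hy, fun h => by simp [h] at hlt, hlt.le⟩
    · have hs : IsSolution (Matrix.of A) ((Matrix.of A).mulVec x) z := by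
        by_contra h
        exact hz (by simp [h, hzx])
      exact ⟨z, hs.1, hzx, hs.2 x hxf⟩
  set v : Fin n → ℝ := y - x
  have hv : v ≠ 0 := sub_ne_zero.2 hyx
  have hs0 : 0 < ∑ i, v i ^ 2 := by
    obtain ⟨i, hi⟩ := Function.ne_iff.1 hv
    exact Finset.sum_pos' (fun i _ => sq_nonneg _) ⟨i, Finset.mem_univ i, by
      have : v i ≠ 0 := hi
      positivity⟩
  set r := √(∑ i, v i ^ 2)
  have hr : 0 < r := Real.sqrt_pos.2 hs0
  have hr2 : r ^ 2 = ∑ i, v i ^ 2 := Real.sq_sqrt hs0.le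
  refine ⟨fun i => r⁻¹ * v i, ⟨?_, ?_, ?_⟩, fun j => ?_⟩
  · simp only [mul_pow]
    rw [← Finset.mul_sum, ← hr2, inv_pow, inv_mul_cancel₀ (by positivity)]
  · rw [← Finset.mul_sum]
    refine mul_nonpos_of_nonneg_of_nonpos (by positivity) ?_
    simp only [l1Norm, abs_of_nonneg (hx _), abs_of_nonneg (hy.2 _)] at hle
    simp only [v, Pi.sub_apply, Finset.sum_sub_distrib]
    linarith
  -- Off the support of `x` the difference equals `y i ≥ 0`, so negative entries occur only on the
  -- support.
  · refine (Finset.card_le_card fun i hi => ?_).trans hk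
    simp only [Finset.mem_filter, Finset.mem_univ, true_and] at hi ⊢
    intro h0
    have : 0 ≤ v i := by simpa [v, h0] using hy.2 i
    exact absurd hi (not_lt.2 (by positivity))
  · have h1 := congrFun hy.1 j
    simp only [Matrix.mulVec, dotProduct, Matrix.of_apply] at h1
    simp only [mul_assoc]
    rw [← Finset.mul_sum]
    have : ∑ i, v i * A j i = 0 := by
      simp only [v, Pi.sub_apply, mul_comm _ (A j _), mul_sub, Finset.sum_sub_distrib]
      linarith
    rw [this, mul_zero]

/-- It suffices to bound the probability that some vector of a finite set of directions is
almost in the kernel. -/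
lemma measure_not_recoversAll_le {k : ℕ} {B : ENNReal}
    (hB : ∀ (N : ℕ) (u : Fin N → Fin n → ℝ), (∀ i, u i ∈ failureDirections n k) →
      gaussianMatrix m n {A | ∃ i, ∑ j, (∑ k, u i k * A j k) ^ 2 ≤ 1} ≤ B) :
    gaussianMatrix m n {A | ¬ RecoversAll k (Matrix.of A)} ≤ B := by
  rcases isEmpty_or_nonempty (failureDirections n k) with hE | hE
  · have : {A : Fin m → Fin n → ℝ | ¬ RecoversAll k (Matrix.of A)} = ∅ := by
      refine Set.eq_empty_of_forall_notMem fun A hA => ?_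
      obtain ⟨w, hw, -⟩ := exists_failureDirection hA
      exact hE.elim ⟨w, hw⟩
    rw [this, measure_empty]
    exact zero_le
  · let d : ℕ → failureDirections n k := TopologicalSpace.denseSeq _
    let S : ℕ → Set (Fin m → Fin n → ℝ) := fun N =>
      {A | ∃ i : Fin N, ∑ j, (∑ k, (d i : Fin n → ℝ) k * A j k) ^ 2 ≤ 1}
    have hmono : Monotone S := fun N N' hN A ⟨i, hi⟩ => ⟨Fin.castLE hN i, hi⟩
    have hsub : {A : Fin m → Fin n → ℝ | ¬ RecoversAll k (Matrix.of A)} ⊆ ⋃ N, S N := by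
      intro A hA
      obtain ⟨w, hw, hker⟩ := exists_failureDirection hA
      -- Near a kernel direction `‖A v‖² < 1` is an open condition, so some point of the dense
      -- sequence satisfies it. This replaces a net, with no count of its points.
      have hcont : Continuous fun v : failureDirections n k =>
          ∑ j, (∑ k, (v : Fin n → ℝ) k * A j k) ^ 2 :=
        continuous_finsetSum _ fun j _ => (continuous_finsetSum _ fun i _ =>
          ((continuous_apply i).comp continuous_subtype_val).mul continuous_const).pow 2
      obtain ⟨i, hi⟩ := (TopologicalSpace.denseRange_denseSeq (failureDirections n k)).exists_mem_open
        (isOpen_Iio.preimage hcont (t := Set.Iio 1)) ⟨⟨w, hw⟩, by simp [hker]⟩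
      exact Set.mem_iUnion.2 ⟨i + 1, Fin.last i, le_of_lt hi⟩
    refine (measure_mono hsub).trans ?_
    rw [hmono.measure_iUnion]
    exact iSup_le fun N => hB N _ fun i => (d i).2

end Recovery

/-! ### The exponential bound -/

/-- Markov's inequality with exponent `c √n`. The dual bound on `⟨h, w⟩` does not depend on `w`, so
no union bound over `W` is needed, and the independence of `g` and `h` factors the expectation. -/
lemma chernoff_vector {α β c γ ν₁ ν₂ η K : ℝ} (hc : 0 < c) (hγ : c / 2 < γ)
    (hν₁ : 0 ≤ ν₁) (hν₂ : 0 ≤ ν₂)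
    (hK : ∀ n m : ℕ, α * n ≤ m →
      ∫ x : Fin m → ℝ, Real.exp (-(c * √n * √(∑ i, x i ^ 2))) ∂gaussianPi (Fin m) ≤
        K * Real.exp (c * n * (ISph c α + η)))
    {n m k : ℕ} (hm : α * n ≤ m) (hk : (k : ℝ) ≤ β * n) {W : Type*} (lam : ℝ)
    (u : W → Fin n → ℝ) (hu : ∀ w, u w ∈ failureDirections n k) :
    ((gaussianPi (Fin m)).prod (gaussianPi (Fin n)))
        {y | ∃ w, √(∑ j, y.1 j ^ 2) - ∑ k, u w k * y.2 k ≤ lam} ≤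
      ENNReal.ofReal (Real.exp (c * √n * lam) * (K * Real.exp (c * n * (ISph c α + η))) *
        Real.exp (c * n * (ν₂ * (2 * β - 1) + γ + 1 / c * Real.log (IPlus c γ ν₁ ν₂)))) := by
  have hI : 0 < IPlus c γ ν₁ ν₂ := IPlus_pos hc hγ
  have hγ0 : 0 < γ := by linarith
  set D : ℝ := Real.exp (c * √n * lam) * Real.exp (c * n * (ν₂ * (2 * β - 1) + γ))
  set f : (Fin m → ℝ) → ℝ := fun x => D * Real.exp (-(c * √n * √(∑ i, x i ^ 2)))
  set g : (Fin n → ℝ) → ℝ := fun x => ∏ i, Real.exp (c * tPlus γ ν₁ ν₂ (x i))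
  have hf : Integrable f (gaussianPi (Fin m)) :=
    (integrable_exp_neg_mul_norm (by positivity)).const_mul D
  have hg : Integrable g (gaussianPi (Fin n)) :=
    Integrable.fintype_prod fun _ => integrable_exp_mul_tPlus hc hγ
  have hfg := hf.mul_prod hg
  have hf0 (x : Fin m → ℝ) : 0 ≤ f x := by positivity
  have hg0 (x : Fin n → ℝ) : 0 ≤ g x := Finset.prod_nonneg fun _ _ => (Real.exp_pos _).le
  have hgint : ∫ x, g x ∂gaussianPi (Fin n) = Real.exp (n * Real.log (IPlus c γ ν₁ ν₂)) := by
    rw [gaussianPi, integral_fintype_prod_eq_prod (fun _ x => Real.exp (c * tPlus γ ν₁ ν₂ x))]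
    simp only [integral_exp_mul_tPlus hc hγ]
    simp [Real.exp_nat_mul, Real.exp_log hI]
  have hsub : {y : (Fin m → ℝ) × (Fin n → ℝ) |
      ∃ w, √(∑ j, y.1 j ^ 2) - ∑ k, u w k * y.2 k ≤ lam} ⊆
      {y | 1 ≤ ENNReal.ofReal (f y.1 * g y.2)} := by
    rintro ⟨x, h⟩ ⟨w, hw⟩
    simp only at hw
    simp only [Set.mem_ofPred_eq, ENNReal.one_le_ofReal]
    have e : f x * g h = Real.exp (c * √n * lam + c * n * (ν₂ * (2 * β - 1) + γ) +
        -(c * √n * √(∑ i, x i ^ 2)) + c * ∑ i, tPlus γ ν₁ ν₂ (h i)) := by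
      simp only [f, g, D]
      rw [← Real.exp_sum, ← Finset.mul_sum, ← Real.exp_add, ← Real.exp_add, ← Real.exp_add]
    rw [e, Real.one_le_exp_iff]
    have h1 := mul_le_mul_of_nonneg_left (sqrt_mul_inner_le hγ0 hν₁ hν₂ (hu w) h) hc.le
    have h2 := mul_le_mul_of_nonneg_left hw (show 0 ≤ c * √n by positivity)
    have h3 : c * (ν₂ * (2 * k)) ≤ c * (ν₂ * (2 * (β * n))) := by gcongr
    nlinarith
  calc ((gaussianPi (Fin m)).prod (gaussianPi (Fin n)))
        {y | ∃ w, √(∑ j, y.1 j ^ 2) - ∑ k, u w k * y.2 k ≤ lam}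
      ≤ ((gaussianPi (Fin m)).prod (gaussianPi (Fin n)))
        {y | 1 ≤ ENNReal.ofReal (f y.1 * g y.2)} := measure_mono hsub
    _ ≤ ∫⁻ y, ENNReal.ofReal (f y.1 * g y.2)
        ∂((gaussianPi (Fin m)).prod (gaussianPi (Fin n))) := by
        simpa using mul_meas_ge_le_lintegral₀ hfg.1.aemeasurable.ennreal_ofReal 1
    _ = ENNReal.ofReal (∫ y, f y.1 * g y.2
        ∂((gaussianPi (Fin m)).prod (gaussianPi (Fin n)))) :=
        (ofReal_integral_eq_lintegral_ofReal hfg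
          (Filter.Eventually.of_forall fun y => mul_nonneg (hf0 _) (hg0 _))).symm
    _ ≤ _ := by
        refine ENNReal.ofReal_le_ofReal ?_
        rw [integral_prod_mul, hgint, integral_const_mul]
        have h1 := hK n m hm
        calc _ ≤ D * (K * Real.exp (c * n * (ISph c α + η))) *
              Real.exp (n * Real.log (IPlus c γ ν₁ ν₂)) := by gcongr
          _ = _ := by
            have e : c * n * (ν₂ * (2 * β - 1) + γ + 1 / c * Real.log (IPlus c γ ν₁ ν₂)) =
              c * n * (ν₂ * (2 * β - 1) + γ) + n * Real.log (IPlus c γ ν₁ ν₂) := by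
              field_simp
            rw [e, Real.exp_add]
            ring

/-- The level is `lam = 2 - c √n`, which turns the scalar factor into `P(g₀ ≤ -c √n)`. Dividing by
its lower bound gives the exponent `c √n (3 - c √n) + (c √n + 1)² / 2 = 1/2 + 4 c √n - c² n / 2`. -/
lemma gaussianMatrix_near_kernel_le {α β c γ ν₁ ν₂ η K : ℝ} (hc : 0 < c) (hγ : c / 2 < γ)
    (hν₁ : 0 ≤ ν₁) (hν₂ : 0 ≤ ν₂)
    (hK : ∀ n m : ℕ, α * n ≤ m →
      ∫ x : Fin m → ℝ, Real.exp (-(c * √n * √(∑ i, x i ^ 2))) ∂gaussianPi (Fin m) ≤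
        K * Real.exp (c * n * (ISph c α + η)))
    {n m k : ℕ} (hm : α * n ≤ m) (hk : (k : ℝ) ≤ β * n) {W : Type*} [Fintype W]
    (u : W → Fin n → ℝ) (hu : ∀ w, u w ∈ failureDirections n k) :
    gaussianMatrix m n {A | ∃ w, ∑ j, (∑ k, u w k * A j k) ^ 2 ≤ 1} ≤
      ENNReal.ofReal (√(2 * Real.pi) * K * Real.exp (1 / 2 + 4 * c * √n +
        c * n * (-c / 2 + (ν₂ * (2 * β - 1) + γ + 1 / c * Real.log (IPlus c γ ν₁ ν₂)) +
          ISph c α + η))) := by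
  set V := ν₂ * (2 * β - 1) + γ + 1 / c * Real.log (IPlus c γ ν₁ ν₂) with hVdef
  have hsq : √(n : ℝ) * √(n : ℝ) = n := Real.mul_self_sqrt (Nat.cast_nonneg n)
  have h1 := gordon_matrix_mul_le (m := m) (2 - c * √n) u fun w => (hu w).1
  have h2 := h1.trans (chernoff_vector hc hγ hν₁ hν₂ hK hm hk (2 - c * √n + 1) u hu)
  have h3 := le_gaussianReal_Iic_neg (t := c * √n) (by positivity)
  rw [show 2 - c * √(n : ℝ) - 2 = -(c * √n) by ring, ← hVdef] at h2
  set q := (√(2 * Real.pi))⁻¹ * Real.exp (-(c * √n + 1) ^ 2 / 2) with hq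
  have hpi : 0 < √(2 * Real.pi) := Real.sqrt_pos.2 (by positivity)
  have hq0 : 0 < q := by positivity
  have h4 := (mul_le_mul_right h3
    (gaussianMatrix m n {A | ∃ w, ∑ j, (∑ k, u w k * A j k) ^ 2 ≤ 1})).trans h2
  rw [← ENNReal.le_div_iff_mul_le (Or.inl (by simpa using hq0)) (Or.inl ENNReal.ofReal_ne_top),
    ← ENNReal.ofReal_div_of_pos hq0] at h4
  refine h4.trans_eq (congrArg _ ?_)
  have e : (1 / 2 + 4 * c * √n + c * n * (-c / 2 + V + ISph c α + η)) =
      c * √n * (2 - c * √n + 1) + c * n * (ISph c α + η) + c * n * V + (c * √n + 1) ^ 2 / 2 := by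
    linear_combination (c ^ 2 / 2) * hsq
  rw [e, hq, div_eq_iff (by positivity), Real.exp_add, Real.exp_add, Real.exp_add, neg_div,
    Real.exp_neg]
  field_simp

/-- `4 c √n` is negligible with respect to `n`. -/
lemma exists_mul_exp_le {C c δ : ℝ} (hC : 0 < C) (hδ : 0 < δ) :
    ∃ N : ℕ, ∀ n : ℕ, N ≤ n →
      C * Real.exp (1 / 2 + 4 * c * √n + -(2 * δ) * n) ≤ Real.exp (-δ * n) := by
  refine ⟨⌈(Real.log C + 1 / 2 + 8 * c ^ 2 / δ) / (δ / 2)⌉₊, fun n hn => ?_⟩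
  have h1 : (Real.log C + 1 / 2 + 8 * c ^ 2 / δ) ≤ n * (δ / 2) := by
    rw [← div_le_iff₀ (by positivity)]
    exact Nat.ceil_le.1 hn
  have hsq : √(n : ℝ) * √(n : ℝ) = n := Real.mul_self_sqrt (Nat.cast_nonneg n)
  -- Arithmetic-geometric mean: half of the spare rate `δ` absorbs the `√n` term, the other half the
  -- constants.
  have h2 : 4 * c * √n ≤ n * (δ / 2) + 8 * c ^ 2 / δ := by
    have h3 : n * (δ / 2) + 8 * c ^ 2 / δ - 4 * c * √n = (δ * √n - 4 * c) ^ 2 / (2 * δ) := by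
      have : 8 * c ^ 2 / δ = 16 * c ^ 2 / (2 * δ) := by
        field_simp
        ring
      rw [this, eq_div_iff (by positivity), sub_mul, add_mul, div_mul_cancel₀ _ (by positivity)]
      linear_combination -(δ ^ 2) * hsq
    have h4 : 0 ≤ (δ * √n - 4 * c) ^ 2 / (2 * δ) := by positivity
    linarith
  calc C * Real.exp (1 / 2 + 4 * c * √n + -(2 * δ) * n)
      = Real.exp (Real.log C + (1 / 2 + 4 * c * √n + -(2 * δ) * n)) := by
        rw [Real.exp_add (Real.log C), Real.exp_log hC]
    _ ≤ _ := Real.exp_le_exp.2 (by linarith)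

lemma exists_params_of_liftedValue_neg {α β : ℝ} (h : liftedValue α β < 0) :
    ∃ c γ ν₁ ν₂ : ℝ, 0 < c ∧ c / 2 < γ ∧ 0 ≤ ν₁ ∧ 0 ≤ ν₂ ∧
      -c / 2 + (ν₂ * (2 * β - 1) + γ + 1 / c * Real.log (IPlus c γ ν₁ ν₂)) + ISph c α < 0 := by
  unfold liftedValue at h
  -- Non-emptiness alone yields an element below any number exceeding the infimum; no lower bound on
  -- the set is needed, here or for `IStrPlus`.
  obtain ⟨_, ⟨c, hc, rfl⟩, hlt⟩ := exists_lt_of_csInf_lt (by exact ⟨_, 1, one_pos, rfl⟩) h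
  have h2 : IStrPlus c β < c / 2 - ISph c α := by linarith
  unfold IStrPlus at h2
  obtain ⟨_, ⟨γ, ν₁, ν₂, hγ, hν₁, hν₂, rfl⟩, hlt2⟩ := exists_lt_of_csInf_lt
    (by exact ⟨_, c, 0, 0, by linarith, le_rfl, le_rfl, rfl⟩) h2
  exact ⟨c, γ, ν₁, ν₂, hc, hγ, hν₁, hν₂, by linarith⟩

theorem exists_exponential_bound {α β : ℝ} (hα : 0 < α) (h : liftedValue α β < 0) :
    ∃ δ : ℝ, 0 < δ ∧ ∃ N : ℕ, ∀ n m k : ℕ, N ≤ n → α * n ≤ m → (k : ℝ) ≤ β * n →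
      gaussianMatrix m n {A | ¬ RecoversAll k (Matrix.of A)}
        ≤ ENNReal.ofReal (Real.exp (-δ * n)) := by
  obtain ⟨c, γ, ν₁, ν₂, hc, hγ, hν₁, hν₂, hV⟩ := exists_params_of_liftedValue_neg h
  set V := -c / 2 + (ν₂ * (2 * β - 1) + γ + 1 / c * Real.log (IPlus c γ ν₁ ν₂)) + ISph c α
    with hVdef
  -- The error `η = -V / 2` leaves the rate `c V / 2 = -2δ` with `δ = -c V / 4`; one `δ` is then
  -- spent on the subexponential factors.
  obtain ⟨K, hK0, hK⟩ := exists_integral_exp_neg_norm_le hα hc (show 0 < -V / 2 by linarith)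
  have hδ : 0 < -(c * V) / 4 := by nlinarith
  obtain ⟨N, hN⟩ := exists_mul_exp_le (c := c)
    (mul_pos (Real.sqrt_pos.2 (by positivity : 0 < 2 * Real.pi)) hK0) hδ
  refine ⟨_, hδ, N, fun n m k hn hm hk => measure_not_recoversAll_le fun M u hu => ?_⟩
  refine (gaussianMatrix_near_kernel_le hc hγ hν₁ hν₂ hK hm hk u hu).trans
    (ENNReal.ofReal_le_ofReal (le_trans (le_of_eq ?_) (hN n hn)))
  rw [← hVdef]
  ring_nf

end NonnegL1

open NonnegL1
theorem mainTheorem2 (α β : ℝ) (hα : 0 < α) (hβ : 0 ≤ β) :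
    (∀ c γ ν₁ ν₂ : ℝ, 0 < c → c / 2 < γ → 0 ≤ ν₁ → 0 ≤ ν₂ →
      MeasureTheory.Integrable (fun h => Real.exp (c * tPlus γ ν₁ ν₂ h))
        (ProbabilityTheory.gaussianReal 0 1) ∧
      ∫ h, Real.exp (c * tPlus γ ν₁ ν₂ h) ∂(ProbabilityTheory.gaussianReal 0 1)
        = IPlus c γ ν₁ ν₂) ∧
    (liftedValue α β < 0 →
      ∃ δ : ℝ, 0 < δ ∧ ∃ N : ℕ, ∀ n m k : ℕ, N ≤ n → α * n ≤ m → (k : ℝ) ≤ β * n →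
        gaussianMatrix m n {A | ¬ RecoversAll k (Matrix.of A)}
          ≤ ENNReal.ofReal (Real.exp (-δ * n))) :=
  ⟨fun _ _ _ _ hc hγ _ _ => ⟨integrable_exp_mul_tPlus hc hγ, integral_exp_mul_tPlus hc hγ⟩,
    exists_exponential_bound hα⟩
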